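/- Let $\mathbb{T}^d=\mathbb{R}^d/\mathbb{Z}^d$ with Lebesgue measure $\lambda$ and the Euclidean distance $|x-y|$ of the torus. For open $U\subset\mathbb{T}^d$ and $0<t<d$ let \[ I_t(U)=\int_U\int_U |x-y|^{-t}\,\mathrm{d}x\,\mathrm{d}y \] be the $t$-dimensional Riesz energy, where $\mathrm{d}x=\mathrm{d}\lambda(x)$. A dyadic cube in $\mathbb{T}^d$ is the image under $\mathbb{R}^d\to\mathbb{T}^d$ of a cube $\prod_{i=1}^d[k_i2^{-n},(k_i+1)2^{-n})$ with $k_1,\dots,k_d,n\in\mathbb{Z}$. Write $|D|$ for the diameter of $D$ and put \[ \mathscr{M}_\infty^t(E)=\inf\Bigl\{\sum_k|D_k|^t : E\subset\bigcup_k D_k,\ D_k \text{ dyadic cubes}\Bigr\}, \] the infimum being over countable covers. For $s\ge 0$, Falconer's class $\mathscr{G}^s(\mathbb{T}^d)$ of sets with large intersections consists of all $G_\delta$-sets $E\subset\mathbb{T}^d$ such that $\mathscr{M}_\infty^t(E\cap D)\ge|D|^t$ for all dyadic cubes $D$ and all $0<t<s$. Theorem. Let $(B(x_j,r_j))_{j=1}^\infty$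 be a sequence of balls in $\mathbb{T}^d$ with $r_j\to0$, and let $(U_j)_{j=1}^\infty$ be a sequence of non-empty open sets with $U_j\subset B(x_j,r_j)$. Let \[ s=\sup\Bigl\{\,0<t<d : \sup_j\frac{I_t(U_j)\,\lambda(B(x_j,r_j))}{\lambda(U_j)^2}<\infty\Bigr\}, \] with $s=0$ if there is no such $t$. Suppose that the set $\limsup_{j\to\infty}B(x_j,r_j)=\bigcap_{k\ge1}\bigcup_{j\ge k}B(x_j,r_j)$ has full Lebesgue measure. Then the set $E_U=\limsup_{j\to\infty}U_j=\bigcap_{k\ge1}\bigcup_{j\ge k}U_j$ satisfies $\dim_{\mathrm H}E_U\ge s$ and $E_U\in\mathscr{G}^s(\mathbb{T}^d)$. -/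

import Mathlib

open MeasureTheory Set Filter Topology
open scoped ENNReal

/-- The torus `𝕋^d = ℝ^d / ℤ^d` with its Euclidean quotient metric: the distance of `x` and `y` is
the square root of the sum over `i` of the squared distances of `x i` and `y i` in `ℝ / ℤ`. -/
abbrev Torus (d : ℕ) : Type := PiLp 2 (fun _ : Fin d => UnitAddCircle)

/-- The projection `π : ℝ^d → 𝕋^d`, `π x = x mod 1`. -/
def torusProj (d : ℕ) (y : Fin d → ℝ) : Torus d :=
  WithLp.toLp 2 (fun i => (y i : UnitAddCircle))

/-- Lebesgue measure on `𝕋^d`: the product of the Lebesgue (probability) measures on the `d` circles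
`ℝ / ℤ`. -/
noncomputable def lebesgueTorus (d : ℕ) : Measure (Torus d) :=
  (volume : Measure (UnitAddTorus (Fin d))).map (WithLp.toLp 2)

/-- The dyadic cube `∏ i, [k i * 2^(-n), (k i + 1) * 2^(-n))` in `ℝ^d`. -/
def dyadicCube {d : ℕ} (n : ℤ) (k : Fin d → ℤ) : Set (Fin d → ℝ) :=
  {y | ∀ i, y i ∈ Ico ((k i : ℝ) * (2 : ℝ) ^ (-n)) (((k i : ℝ) + 1) * (2 : ℝ) ^ (-n))}

/-- Dyadic cubes in the torus are the projections of the dyadic cubes in `ℝ^d`. -/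
def IsDyadicCube {d : ℕ} (D : Set (Torus d)) : Prop :=
  ∃ (n : ℤ) (k : Fin d → ℤ), D = torusProj d '' dyadicCube n k

/-- The outer content `ℳ_∞^t(E)`: the infimum of `∑ |D|^t` over countable covers of `E` by dyadic
cubes `D`, where `|D|` is the diameter. -/
noncomputable def dyadicContent {d : ℕ} (t : ℝ) (E : Set (Torus d)) : ℝ≥0∞ :=
  ⨅ (C : Set (Set (Torus d))) (_ : C.Countable) (_ : ∀ D ∈ C, IsDyadicCube D) (_ : E ⊆ ⋃₀ C),
    ∑' D : C, Metric.ediam (D : Set (Torus d)) ^ t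

/-- Falconer's class `𝒢^s(𝕋^d)` of sets with large intersections: the `G_δ` sets `E` with
`ℳ_∞^t(E ∩ D) ≥ |D|^t` for all dyadic cubes `D` and all exponents `0 < t < s`. -/
def largeIntersectionClass (d : ℕ) (s : ℝ) : Set (Set (Torus d)) :=
  {E | IsGδ E ∧ ∀ D : Set (Torus d), IsDyadicCube D → ∀ t : ℝ, 0 < t → t < s →
    Metric.ediam D ^ t ≤ dyadicContent t (E ∩ D)}

/-- The `t`-dimensional Riesz energy `I_t(U) = ∫_U ∫_U |x - y|^(-t) dx dy`, with values in
`[0, ∞]`. -/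
noncomputable def rieszEnergy {d : ℕ} (t : ℝ) (U : Set (Torus d)) : ℝ≥0∞ :=
  ∫⁻ y in U, ∫⁻ x in U, edist x y ^ (-t) ∂(lebesgueTorus d) ∂(lebesgueTorus d)

/-- The supremum of those `t ∈ (0, d)` for which
`sup_j I_t(U_j) λ(B(x_j, r_j)) / λ(U_j)^2 < ∞` (and `0` if there is no such `t`). -/
noncomputable def energyExponent {d : ℕ} (x : ℕ → Torus d) (r : ℕ → ℝ) (U : ℕ → Set (Torus d)) :
    ℝ :=
  sSup {t : ℝ | 0 < t ∧ t < d ∧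
    ⨆ j, rieszEnergy t (U j) * lebesgueTorus d (Metric.ball (x j) (r j)) /
      lebesgueTorus d (U j) ^ 2 < ∞}

/-! Let ν be Lebesgue measure. Fix τ < s and an admissible exponent t > τ, and shrink each U_j to
W_j with closure in U_j and at least half the measure. The core is
`IsEnergySystem.measure_le_tsum_closure`: if countably many S_i with ∑ |S_i|^τ < ∞ cover the part of
limsup closure(W_j) in an open V, then ν(V) ≤ ∑ ν(closure S_i), with no constant lost.

The mechanism is mass transference, starting from ν restricted to V. Given a measure of bounded
density, Vitali's theorem yields finitely many tiny balls B_j whose triples are disjoint and carry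
almost all the mass; the mass of each 3B_j is spread uniformly over W_j. Interactions between
different balls barely change, because the triples keep them apart. The self-interaction of W_j is
controlled by its t-energy, and the gap t - τ gives a small factor that beats the density bound.
Hence strict bounds on the total mass, the τ-energy and the masses of finitely many closed sets
survive (`IsMassBound.exists_next`). The supports are nested, so by compactness finitely many steps
bring the measure into any open neighbourhood of V ∩ limsup closure(W_j); no limit measure is
needed.

Apply this to a union of thickenings of the S_i. Finitely many of them carry little more than their
ν-mass; the others carry little, because a measure of bounded energy is small on sets with small ∑
|S_i|^τ (`measure_iUnion_le_energy`). So ν(V) cannot exceed ∑ ν(closure S_i).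

For the content bound, V is an open box in D, and the exact constant 1 comes from the rigid relation
between diameter and volume of dyadic cubes. For the dimension, V is the whole torus. -/

/-! ### Riesz energies and potentials on a compact metric space -/

section RieszEnergy

variable {X : Type*} [MetricSpace X] [MeasurableSpace X]

/-- The mutual Riesz energy `∫ ∫ |x - y|^(-t) dμ(x) dν(y)` of two measures. -/
noncomputable def mutualEnergy (t : ℝ) (μ ν : Measure X) : ℝ≥0∞ :=
  ∫⁻ y, ∫⁻ x, edist x y ^ (-t) ∂μ ∂ν

theorem mutualEnergy_mono {t : ℝ} {μ μ' ν ν' : Measure X} (hμ : μ ≤ μ') (hν : ν ≤ ν') :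
    mutualEnergy t μ ν ≤ mutualEnergy t μ' ν' :=
  lintegral_mono' hν fun _ => lintegral_mono' hμ le_rfl

/-- Passing to a smaller exponent on a set of small diameter. -/
theorem mutualEnergy_restrict_le_of_lt {τ t D : ℝ} (hτ : 0 < τ) (hτt : τ < t) (hD : 0 < D)
    (ν : Measure X) {S : Set X} (hS : MeasurableSet S) (hSD : ∀ x ∈ S, ∀ y ∈ S, dist x y ≤ D) :
    mutualEnergy τ (ν.restrict S) (ν.restrict S) ≤
      ENNReal.ofReal D ^ (t - τ) * mutualEnergy t (ν.restrict S) (ν.restrict S) := by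
  unfold mutualEnergy
  have htop : ENNReal.ofReal D ^ (t - τ) ≠ ∞ :=
    ENNReal.rpow_ne_top_of_nonneg (by linarith) ENNReal.ofReal_ne_top
  rw [← lintegral_const_mul' _ _ htop]
  refine setLIntegral_mono' hS fun y hy => ?_
  rw [← lintegral_const_mul' _ _ htop]
  refine setLIntegral_mono' hS fun x hx => ?_
  have hle : edist x y ≤ ENNReal.ofReal D := by
    rw [edist_dist]; exact ENNReal.ofReal_le_ofReal (hSD x hx y hy)
  rcases eq_or_ne (edist x y) 0 with h0 | h0
  · rw [h0, ENNReal.zero_rpow_of_neg (by linarith : -t < 0), ENNReal.mul_top]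
    · exact le_top
    · simp [hD]
  · calc edist x y ^ (-τ) = edist x y ^ (t - τ) * edist x y ^ (-t) := by
          rw [← ENNReal.rpow_add _ _ h0 (edist_ne_top _ _)]; congr 1; ring
      _ ≤ _ := by gcongr

variable [CompactSpace X] [BorelSpace X]

theorem measurable_riesz_potential (t : ℝ) (μ : Measure X) [SFinite μ] :
    Measurable fun y => ∫⁻ x, edist x y ^ (-t) ∂μ :=
  Measurable.lintegral_prod_left' (f := fun p : X × X => edist p.1 p.2 ^ (-t))
    (measurable_edist.pow_const _)

theorem mutualEnergy_sum_smul {ι : Type*} (t : ℝ) (J : Finset ι) (c : ι → ℝ≥0∞)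
    (ρ : ι → Measure X) [∀ i, IsFiniteMeasure (ρ i)] :
    mutualEnergy t (∑ j ∈ J, c j • ρ j) (∑ j ∈ J, c j • ρ j) =
      ∑ i ∈ J, ∑ j ∈ J, c i * (c j * mutualEnergy t (ρ j) (ρ i)) := by
  unfold mutualEnergy
  rw [lintegral_finsetSum_measure]
  refine Finset.sum_congr rfl fun i _ => ?_
  rw [lintegral_smul_measure, smul_eq_mul, ← Finset.mul_sum]
  congr 1
  rw [← Finset.sum_congr rfl fun j _ =>
    lintegral_const_mul (c j) (measurable_riesz_potential t (ρ j)),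
    ← lintegral_finsetSum _ fun j _ => (measurable_riesz_potential t (ρ j)).const_mul (c j)]
  refine lintegral_congr fun y => ?_
  rw [lintegral_finsetSum_measure]
  simp [lintegral_smul_measure]

/-- The kernel controlling `|x - y|^(-t)` when `x` and `y` are moved by at most `4δ` each, and
their distance changes by a factor at most `5`. -/
noncomputable def perturbedKernel (t : ℝ) (δ : ℝ) (p : X × X) : ℝ≥0∞ :=
  max (edist p.1 p.2 / 5) (edist p.1 p.2 - ENNReal.ofReal (8 * δ)) ^ (-t)

theorem measurable_perturbedKernel (t δ : ℝ) :
    Measurable (perturbedKernel (X := X) t δ) := by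
  unfold perturbedKernel
  have := measurable_edist (α := X)
  exact ((this.div_const _).max (this.sub_const _)).pow_const _

/-- Dominated convergence: the first term of the maximum keeps the kernel below 5^t |x - y|^(-t),
which is integrable, and the second makes it converge pointwise to |x - y|^(-t). -/
theorem tendsto_lintegral_perturbedKernel {t : ℝ} (ht : 0 < t) (μ : Measure X) [IsFiniteMeasure μ]
    (hfin : mutualEnergy t μ μ ≠ ∞) :
    Tendsto (fun δ : ℝ => ∫⁻ p, perturbedKernel t δ p ∂(μ.prod μ)) (𝓝[>] 0)
      (𝓝 (mutualEnergy t μ μ)) := by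
  have hE : mutualEnergy t μ μ = ∫⁻ p : X × X, edist p.1 p.2 ^ (-t) ∂(μ.prod μ) := by
    rw [lintegral_prod_symm _ (measurable_edist.pow_const _).aemeasurable]
    rfl
  rw [hE] at hfin ⊢
  refine tendsto_lintegral_filter_of_dominated_convergence
    (fun p => 5 ^ t * edist p.1 p.2 ^ (-t)) (.of_forall fun δ => measurable_perturbedKernel t δ)
    (.of_forall fun δ => .of_forall fun p => ?_) ?_ (.of_forall fun p => ?_)
  · have h5 : (edist p.1 p.2 / 5) ^ (-t) = 5 ^ t * edist p.1 p.2 ^ (-t) := by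
      rw [div_eq_mul_inv, ENNReal.mul_rpow_of_ne_top (edist_ne_top _ _) (by simp),
        ENNReal.inv_rpow, ENNReal.rpow_neg 5, inv_inv, mul_comm]
    rw [← h5, perturbedKernel, ENNReal.rpow_neg, ENNReal.rpow_neg, ENNReal.inv_le_inv]
    gcongr
    exact le_max_left _ _
  · rw [lintegral_const_mul' _ _ (by simp [ENNReal.rpow_ne_top_of_nonneg ht.le])]
    exact ENNReal.mul_ne_top (by simp [ENNReal.rpow_ne_top_of_nonneg ht.le]) hfin
  · refine (ENNReal.continuous_rpow_const.tendsto _).comp ?_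
    have h1 : Tendsto (fun δ : ℝ => ENNReal.ofReal (8 * δ)) (𝓝[>] 0) (𝓝 0) := by
      have : Continuous fun δ : ℝ => ENNReal.ofReal (8 * δ) :=
        ENNReal.continuous_ofReal.comp (continuous_const.mul continuous_id)
      simpa using (this.tendsto 0).mono_left nhdsWithin_le_nhds
    have h2 := (tendsto_const_nhds (x := edist p.1 p.2 / 5)).max
      (ENNReal.Tendsto.sub (tendsto_const_nhds (x := edist p.1 p.2)) h1
        (.inl (edist_ne_top _ _)))
    rwa [tsub_zero, max_eq_right (ENNReal.div_le_of_le_mul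
      (le_mul_of_one_le_right (by simp) (by norm_num)))] at h2

/-- The measure of a countable union is controlled by the energy and the sum of the powers of the
diameters: outside a set of measure at most `κ I_t(μ)` the potential of `μ` is at most `κ⁻¹`. -/
theorem measure_iUnion_le_energy {ι : Type*} [Countable ι] {t : ℝ} (ht : 0 < t) (μ : Measure X)
    [IsFiniteMeasure μ] (O : ι → Set X) {κ : ℝ≥0∞} (hκ : κ ≠ 0) (hκ' : κ ≠ ∞) :
    μ (⋃ i, O i) ≤ κ * mutualEnergy t μ μ + κ⁻¹ * ∑' i, Metric.ediam (O i) ^ t := by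
  set p : X → ℝ≥0∞ := fun y => ∫⁻ x, edist x y ^ (-t) ∂μ with hp
  set B : Set X := {y | κ⁻¹ ≤ p y} with hB
  have hBle : μ B ≤ κ * mutualEnergy t μ μ := by
    have := meas_ge_le_lintegral_div (measurable_riesz_potential t μ).aemeasurable
      (μ := μ) (ε := κ⁻¹) (by simpa) (by simpa)
    rwa [ENNReal.div_eq_inv_mul, inv_inv] at this
  have hO : ∀ i, μ (O i \ B) ≤ κ⁻¹ * Metric.ediam (O i) ^ t := by
    intro i
    rcases (O i \ B).eq_empty_or_nonempty with h | ⟨y, hy, hyB⟩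
    · simp [h]
    have hpy : p y < κ⁻¹ := not_le.1 hyB
    have h1 : Metric.ediam (O i) ^ (-t) * μ (O i) ≤ p y := by
      calc _ = ∫⁻ _ in O i, Metric.ediam (O i) ^ (-t) ∂μ := by simp
        -- `O i` need not be measurable; its closure is, and has the same diameter.
        _ ≤ ∫⁻ x in closure (O i), edist x y ^ (-t) ∂μ := by
          refine (lintegral_mono_set subset_closure).trans
            (setLIntegral_mono' isClosed_closure.measurableSet fun x hx => ?_)
          rw [ENNReal.rpow_neg, ENNReal.rpow_neg, ENNReal.inv_le_inv]
          gcongr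
          rw [← Metric.ediam_closure]
          exact Metric.edist_le_ediam_of_mem hx (subset_closure hy)
        _ ≤ _ := setLIntegral_le_lintegral _ _
    refine (measure_mono sdiff_subset).trans ?_
    have h2 := h1.trans hpy.le
    rcases eq_or_ne (Metric.ediam (O i)) 0 with h0 | h0
    · rw [h0, ENNReal.zero_rpow_of_neg (by linarith)] at h1
      have : μ (O i) = 0 := by
        by_contra hne
        rw [ENNReal.top_mul hne] at h1
        exact absurd (top_le_iff.1 h1) (hpy.trans_le le_top).ne
      simp [this]
    rcases eq_or_ne (Metric.ediam (O i)) ∞ with htop | htop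
    · rw [htop, ENNReal.top_rpow_of_pos ht, ENNReal.mul_top (by simpa)]
      exact le_top
    · calc μ (O i) = Metric.ediam (O i) ^ (-t) * μ (O i) * Metric.ediam (O i) ^ t := by
            rw [mul_right_comm, ← ENNReal.rpow_add _ _ h0 htop]; simp
        _ ≤ _ := by gcongr
  calc μ (⋃ i, O i) ≤ μ (B ∪ ⋃ i, O i \ B) := by
        refine measure_mono fun x hx => ?_
        by_cases h : x ∈ B
        · exact .inl h
        · obtain ⟨i, hi⟩ := mem_iUnion.1 hx
          exact .inr (mem_iUnion.2 ⟨i, hi, h⟩)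
    _ ≤ μ B + ∑' i, μ (O i \ B) :=
        (measure_union_le _ _).trans (by gcongr; exact measure_iUnion_le _)
    _ ≤ _ := by
        rw [← ENNReal.tsum_mul_left]
        gcongr with i
        exact hO i

end RieszEnergy

/-! ### Redistributing mass, and the Vitali selection of balls -/

section Redistribution

variable {X : Type*} [MeasurableSpace X]

/-- Move the mass `μ (P j)` uniformly onto `W j`, for `j ∈ J`. -/
noncomputable def redistribute (μ ν : Measure X)
    (P W : ℕ → Set X) (J : Finset ℕ) : Measure X :=
  ∑ j ∈ J, (μ (P j) / ν (W j)) • ν.restrict (W j)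

variable {μ ν : Measure X} {P W : ℕ → Set X} {J : Finset ℕ}

theorem redistribute_univ [IsFiniteMeasure ν] (hW0 : ∀ j, ν (W j) ≠ 0) :
    redistribute μ ν P W J univ = ∑ j ∈ J, μ (P j) := by
  simp [redistribute, ENNReal.div_mul_cancel (hW0 _) (measure_ne_top _ _)]

/-- Only those `P j` whose `W j` meets `S` send mass to `S`. In the application `S'` is a thickening
of `S`. -/
theorem redistribute_le_of_subset [IsFiniteMeasure ν] (hW0 : ∀ j, ν (W j) ≠ 0)
    (hPm : ∀ j, MeasurableSet (P j)) (hd : (J : Set ℕ).PairwiseDisjoint P)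
    {S S' : Set X} (hS : MeasurableSet S)
    (hSS' : ∀ j ∈ J, (S ∩ W j).Nonempty → P j ⊆ S') :
    redistribute μ ν P W J S ≤ μ S' := by
  classical
  calc redistribute μ ν P W J S
      ≤ ∑ j ∈ J with (S ∩ W j).Nonempty, μ (P j) := by
        rw [redistribute, Finset.sum_filter, Measure.finsetSum_apply]
        refine Finset.sum_le_sum fun j _ => ?_
        split_ifs with h
        · rw [Measure.smul_apply, smul_eq_mul, Measure.restrict_apply hS]
          calc μ (P j) / ν (W j) * ν (S ∩ W j) ≤ μ (P j) / ν (W j) * ν (W j) := by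
                gcongr; exact inter_subset_right
            _ = _ := ENNReal.div_mul_cancel (hW0 _) (measure_ne_top _ _)
        · rw [not_nonempty_iff_eq_empty] at h
          simp [Measure.restrict_apply hS, h]
    _ = μ (⋃ j ∈ J.filter fun j => (S ∩ W j).Nonempty, P j) := by
        rw [measure_biUnion_finset (hd.subset (by simp +contextual [subset_def])) fun j _ => hPm j]
    _ ≤ μ S' := by
        refine measure_mono (iUnion₂_subset fun j hj => ?_)
        rw [Finset.mem_filter] at hj
        exact hSS' j hj.1 hj.2

/-- Bounded density is preserved, with no control of the bound; this suffices because each step may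
choose its scale after seeing the density. -/
theorem exists_redistribute_le_smul [IsFiniteMeasure μ] (hW0 : ∀ j, ν (W j) ≠ 0) :
    ∃ L : ℝ≥0∞, L ≠ ∞ ∧ redistribute μ ν P W J ≤ L • ν := by
  refine ⟨∑ j ∈ J, μ (P j) / ν (W j), ?_, ?_⟩
  · exact ENNReal.sum_ne_top.2 fun j _ => ENNReal.div_ne_top (measure_ne_top _ _) (hW0 j)
  · rw [redistribute, Finset.sum_smul]
    refine Finset.sum_le_sum fun j _ => ?_
    refine Measure.le_iff.2 fun s hs => ?_
    simp only [Measure.smul_apply, smul_eq_mul]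
    gcongr
    exact Measure.restrict_le_self

theorem redistribute_compl_eq_zero (hWm : ∀ j, MeasurableSet (W j)) :
    redistribute μ ν P W J (⋃ j ∈ J, W j)ᶜ = 0 := by
  rw [redistribute, Measure.finsetSum_apply]
  refine Finset.sum_eq_zero fun j hj => ?_
  rw [Measure.smul_apply, Measure.restrict_apply (J.measurableSet_biUnion fun j _ => hWm j).compl,
    (disjoint_compl_left_iff_subset.2 (J.subset_set_biUnion_of_mem (f := W) hj)).inter_eq]
  simp

variable [MetricSpace X] [IsFiniteMeasure ν]

/-- Off-diagonal terms of the energy of a redistributed measure. -/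
theorem mul_mutualEnergy_le_lintegral (hW0 : ∀ j, ν (W j) ≠ 0) (hWm : ∀ j, MeasurableSet (W j))
    (hPm : ∀ j, MeasurableSet (P j)) {t : ℝ} {φ : X × X → ℝ≥0∞} {i j : ℕ}
    (hφ : ∀ y ∈ W i, ∀ x ∈ W j, ∀ y' ∈ P i, ∀ x' ∈ P j, edist x y ^ (-t) ≤ φ (y', x')) :
    μ (P i) / ν (W i) * (μ (P j) / ν (W j) *
      mutualEnergy t (ν.restrict (W j)) (ν.restrict (W i))) ≤
      ∫⁻ y in P i, ∫⁻ x in P j, φ (y, x) ∂μ ∂μ := by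
  -- The constant `M` separates the two sides: it dominates the kernel on `W i × W j` and is
  -- dominated by `φ` everywhere on `P i × P j`.
  set M : ℝ≥0∞ := ⨆ (y ∈ W i) (x ∈ W j), edist x y ^ (-t) with hM
  have h1 : mutualEnergy t (ν.restrict (W j)) (ν.restrict (W i)) ≤ M * ν (W j) * ν (W i) := by
    calc _ ≤ ∫⁻ y in W i, ∫⁻ x in W j, M ∂ν ∂ν := by
          refine setLIntegral_mono' (hWm i) fun y hy => setLIntegral_mono' (hWm j) fun x hx => ?_
          exact le_iSup₂_of_le y hy (le_iSup₂ (f := fun x _ => edist x y ^ (-t)) x hx)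
      _ = _ := by simp
  calc _ ≤ μ (P i) / ν (W i) * (μ (P j) / ν (W j) * (M * ν (W j) * ν (W i))) := by gcongr
    _ = M * (μ (P j) / ν (W j) * ν (W j)) * (μ (P i) / ν (W i) * ν (W i)) := by ring
    _ = M * μ (P j) * μ (P i) := by
        rw [ENNReal.div_mul_cancel (hW0 _) (measure_ne_top _ _),
          ENNReal.div_mul_cancel (hW0 _) (measure_ne_top _ _)]
    _ = ∫⁻ y in P i, ∫⁻ x in P j, M ∂μ ∂μ := by simp
    _ ≤ _ := by
      refine setLIntegral_mono' (hPm i) fun y' hy' => setLIntegral_mono' (hPm j) fun x' hx' => ?_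
      exact iSup₂_le fun y hy => iSup₂_le fun x hx => hφ y hy x hx y' hy' x' hx'

/-- Expand the energy into blocks indexed by pairs. The products `P i × P j` are disjoint, so the
off-diagonal blocks add up to at most the integral of `φ`; the diagonal ones add up to at most `D`
times the mass. -/
theorem mutualEnergy_redistribute_le [CompactSpace X] [BorelSpace X] [IsFiniteMeasure μ]
    (hW0 : ∀ j, ν (W j) ≠ 0) (hWm : ∀ j, MeasurableSet (W j))
    (hPm : ∀ j, MeasurableSet (P j)) (hd : (J : Set ℕ).PairwiseDisjoint P) {t : ℝ}
    {φ : X × X → ℝ≥0∞} (hφm : Measurable φ)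
    (hφ : ∀ i ∈ J, ∀ j ∈ J, i ≠ j → ∀ y ∈ W i, ∀ x ∈ W j, ∀ y' ∈ P i, ∀ x' ∈ P j,
      edist x y ^ (-t) ≤ φ (y', x'))
    {D : ℝ≥0∞}
    (hD : ∀ j ∈ J, μ (P j) / ν (W j) * (μ (P j) / ν (W j) *
      mutualEnergy t (ν.restrict (W j)) (ν.restrict (W j))) ≤ D * μ (P j)) :
    mutualEnergy t (redistribute μ ν P W J) (redistribute μ ν P W J) ≤
      ∫⁻ p, φ p ∂(μ.prod μ) + D * μ univ := by
  classical
  unfold redistribute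
  rw [mutualEnergy_sum_smul]
  calc _ ≤ ∑ i ∈ J, ∑ j ∈ J, ((∫⁻ y in P i, ∫⁻ x in P j, φ (y, x) ∂μ ∂μ) +
        if i = j then D * μ (P j) else 0) := by
        refine Finset.sum_le_sum fun i hi => Finset.sum_le_sum fun j hj => ?_
        split_ifs with hij
        · subst hij
          exact (hD i hi).trans le_add_self
        · rw [add_zero]
          exact mul_mutualEnergy_le_lintegral hW0 hWm hPm (hφ i hi j hj hij)
    _ = ∑ i ∈ J, ∑ j ∈ J, (∫⁻ y in P i, ∫⁻ x in P j, φ (y, x) ∂μ ∂μ) +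
          D * ∑ i ∈ J, μ (P i) := by
        simp_rw [Finset.sum_add_distrib, Finset.mul_sum]
        congr 1
        refine Finset.sum_congr rfl fun i hi => ?_
        simp [hi]
    _ ≤ _ := by
        gcongr
        · have hmeas : ∀ j, Measurable fun y => ∫⁻ x in P j, φ (y, x) ∂μ := fun j =>
            hφm.lintegral_prod_right'
          calc _ = ∑ i ∈ J, ∫⁻ y in P i, ∑ j ∈ J, ∫⁻ x in P j, φ (y, x) ∂μ ∂μ := by
                refine Finset.sum_congr rfl fun i _ => ?_
                rw [lintegral_finsetSum _ fun j _ => hmeas j]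
            _ ≤ ∑ i ∈ J, ∫⁻ y in P i, ∫⁻ x, φ (y, x) ∂μ ∂μ := by
                refine Finset.sum_le_sum fun i _ => lintegral_mono fun y => ?_
                dsimp only
                rw [← lintegral_biUnion_finset hd fun j _ => hPm j]
                exact setLIntegral_le_lintegral _ _
            _ ≤ ∫⁻ y, ∫⁻ x, φ (y, x) ∂μ ∂μ := by
                rw [← lintegral_biUnion_finset hd fun j _ => hPm j]
                exact setLIntegral_le_lintegral _ _
            _ = _ := (lintegral_prod _ hφm.aemeasurable).symm
        · rw [← measure_biUnion_finset hd fun j _ => hPm j]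
          exact measure_mono (subset_univ _)

/-- Vitali covering: the balls `B(x_j, r_j)` whose limsup set has full measure contain finitely
many arbitrarily small ones whose threefold enlargements are disjoint, contained in a given open
set, and carry almost all of the mass of a given absolutely continuous measure. -/
theorem exists_finset_pairwiseDisjoint_closedBall [CompactSpace X] [BorelSpace X]
    {C : ℝ≥0∞} (hC : C ≠ ∞)
    (hdoub : ∀ c : X, ∀ ρ : ℝ, 0 < ρ →
      ν (Metric.closedBall c (13 * ρ)) ≤ C * ν (Metric.ball c ρ))
    {x : ℕ → X} {r : ℕ → ℝ} (hr : Tendsto r atTop (𝓝 0)) (hr0 : ∀ j, 0 < r j)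
    (hfull : ν (limsup (fun j => Metric.ball (x j) (r j)) atTop)ᶜ = 0)
    {μ : Measure X} (hμν : μ ≪ ν) {V : Set X} (hV : IsOpen V) (hμV : μ Vᶜ = 0)
    {a : ℝ≥0∞} (ha : a < μ univ) (k : ℕ) {δ : ℝ} (hδ : 0 < δ) :
    ∃ J : Finset ℕ, (∀ j ∈ J, k ≤ j ∧ r j ≤ δ ∧ Metric.closedBall (x j) (3 * r j) ⊆ V) ∧
      (J : Set ℕ).PairwiseDisjoint (fun j => Metric.closedBall (x j) (3 * r j)) ∧
      a < ∑ j ∈ J, μ (Metric.closedBall (x j) (3 * r j)) := by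
  set P : ℕ → Set X := fun j => Metric.closedBall (x j) (3 * r j) with hP
  set T : Set (X × ℕ) := {q | q.1 ∈ Metric.ball (x q.2) (r q.2) ∧ k ≤ q.2 ∧ r q.2 ≤ δ ∧ P q.2 ⊆ V}
    with hT
  set s : Set X := V ∩ limsup (fun j => Metric.ball (x j) (r j)) atTop with hs
  -- The Vitali family is centred at points of `s`, so it is indexed by pairs (y, j) with y in
  -- B(x_j, r_j). Then 3B_j lies in the ball of radius 4r_j about y, whose triple lies in 13B_j:
  -- this is the source of the constant 13.
  obtain ⟨u, huT, huc, hud, hu0⟩ := Vitali.exists_disjoint_covering_ae ν s T C.toNNReal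
    (fun q => 4 * r q.2) (fun q => q.1) (fun q => P q.2)
    (fun q hq => Metric.closedBall_subset_closedBall' (by
      have := Metric.mem_ball.1 hq.1; rw [dist_comm] at this; linarith))
    (fun q hq => by
      rw [ENNReal.coe_toNNReal hC]
      calc ν (Metric.closedBall q.1 (3 * (4 * r q.2)))
          ≤ ν (Metric.closedBall (x q.2) (13 * r q.2)) :=
            measure_mono (Metric.closedBall_subset_closedBall' (by
              have := Metric.mem_ball.1 hq.1; linarith))
        _ ≤ _ := hdoub _ _ (hr0 _)
        _ ≤ _ := by
          gcongr
          exact Metric.ball_subset_closedBall.trans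
            (Metric.closedBall_subset_closedBall (by linarith [hr0 q.2])))
    (fun q _ => ⟨x q.2, Metric.ball_subset_interior_closedBall
      (Metric.mem_ball_self (by linarith [hr0 q.2]))⟩)
    (fun q _ => Metric.isClosed_closedBall)
    (fun y hy ε hε => by
      obtain ⟨hyV, hyl⟩ := hy
      obtain ⟨η, hη, hηV⟩ := Metric.isOpen_iff.1 hV y hyV
      rw [mem_limsup_iff_frequently_mem] at hyl
      have hsmall : ∀ᶠ j in atTop, k ≤ j ∧ r j < min δ (min (ε / 4) (η / 4)) :=
        (eventually_ge_atTop k).and (hr.eventually_lt_const (by positivity))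
      obtain ⟨j, hyj, hkj, hrj⟩ := (hyl.and_eventually hsmall).exists
      simp only [lt_min_iff] at hrj
      refine ⟨(y, j), ⟨hyj, hkj, hrj.1.le, fun z hz => hηV ?_⟩, by simp; linarith, rfl⟩
      have h1 := Metric.mem_ball.1 hyj
      have h2 := Metric.mem_closedBall.1 hz
      have h3 := dist_triangle_right z y (x j)
      rw [Metric.mem_ball]
      linarith)
  have hinj : InjOn Prod.snd u := by
    intro p hp q hq hpq
    by_contra hne
    have := hud hp hq hne
    simp only [Function.onFun, hpq, disjoint_self] at this
    have hx : x q.2 ∈ P q.2 := Metric.mem_closedBall_self (by linarith [hr0 q.2])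
    rw [this] at hx
    exact hx
  set I : Set ℕ := Prod.snd '' u with hI
  have hId : I.PairwiseDisjoint P := by
    rintro _ ⟨p, hp, rfl⟩ _ ⟨q, hq, rfl⟩ hpq
    exact hud hp hq fun h => hpq (by rw [h])
  have hIU : ⋃ j ∈ I, P j = ⋃ q ∈ u, P q.2 := by rw [hI, biUnion_image]
  have hμI : a < ∑' j : I, μ (P j) := by
    rw [← measure_biUnion (to_countable I) hId fun j _ => Metric.isClosed_closedBall.measurableSet,
      hIU]
    refine ha.trans_le ?_
    calc μ univ ≤ μ ((⋃ q ∈ u, P q.2) ∪ ((s \ ⋃ q ∈ u, P q.2) ∪ (Vᶜ ∪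
            (limsup (fun j => Metric.ball (x j) (r j)) atTop)ᶜ))) := by
          refine measure_mono fun y _ => ?_
          by_cases h1 : y ∈ ⋃ q ∈ u, P q.2
          · exact .inl h1
          · by_cases h2 : y ∈ V
            · by_cases h3 : y ∈ limsup (fun j => Metric.ball (x j) (r j)) atTop
              · exact .inr (.inl ⟨⟨h2, h3⟩, h1⟩)
              · exact .inr (.inr (.inr h3))
            · exact .inr (.inr (.inl h2))
      _ ≤ μ (⋃ q ∈ u, P q.2) + 0 := by
          refine (measure_union_le _ _).trans ?_
          gcongr
          exact le_of_eq (measure_union_null (hμν hu0) (measure_union_null hμV (hμν hfull)))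
      _ = _ := add_zero _
  rw [ENNReal.tsum_eq_iSup_sum, lt_iSup_iff] at hμI
  obtain ⟨J, hJ⟩ := hμI
  refine ⟨J.map (Function.Embedding.subtype _), fun j hj => ?_, fun i hi j hj hij => ?_, ?_⟩
  · obtain ⟨⟨_, ⟨q, hq, rfl⟩⟩, -, rfl⟩ := Finset.mem_map.1 hj
    exact (huT hq).2
  · obtain ⟨i', -, rfl⟩ := Finset.mem_map.1 hi
    obtain ⟨j', -, rfl⟩ := Finset.mem_map.1 hj
    exact hId i'.2 j'.2 hij
  · simpa [Finset.sum_map] using hJ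

end Redistribution

/-! ### The transference step and its iteration -/

section Transference

variable {X : Type*} [MetricSpace X]

/-- Disjointness of the triples gives |x - y| > 2r and |x - y| > 2r'. As |x' - y'| ≤ |x - y| + 4r +
4r', the right side is at most both 5|x - y| and |x - y| + 8δ. -/
theorem edist_rpow_neg_le_perturbedKernel {c c' x y x' y' : X} {r r' δ t : ℝ} (ht : 0 < t)
    (hd : Disjoint (Metric.closedBall c (3 * r)) (Metric.closedBall c' (3 * r')))
    (hr : r ≤ δ) (hr' : r' ≤ δ)
    (hy : y ∈ Metric.ball c r) (hx : x ∈ Metric.ball c' r')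
    (hy' : y' ∈ Metric.closedBall c (3 * r)) (hx' : x' ∈ Metric.closedBall c' (3 * r')) :
    edist x y ^ (-t) ≤ perturbedKernel t δ (y', x') := by
  have hr0 : 0 < r := Metric.pos_of_mem_ball hy
  have hr0' : 0 < r' := Metric.pos_of_mem_ball hx
  have h1 : 3 * r' < dist y c' := by
    by_contra! h
    exact disjoint_left.1 hd (Metric.ball_subset_closedBall
      (Metric.ball_subset_ball (by linarith) hy)) (Metric.mem_closedBall.2 h)
  have h2 : 3 * r < dist x c := by
    by_contra! h
    exact disjoint_right.1 hd (Metric.ball_subset_closedBall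
      (Metric.ball_subset_ball (by linarith) hx)) (Metric.mem_closedBall.2 h)
  rw [Metric.mem_ball] at hy hx
  rw [Metric.mem_closedBall] at hy' hx'
  have h3 := dist_triangle y x c'
  have h4 := dist_triangle x y c
  have h5 := dist_triangle4 y' c y x'
  have h6 := dist_triangle4 y x c' x'
  rw [dist_comm y x] at h3 h6
  rw [dist_comm c y] at h5
  rw [dist_comm c' x'] at h6
  rw [perturbedKernel, ENNReal.rpow_neg, ENNReal.rpow_neg, ENNReal.inv_le_inv]
  gcongr
  refine max_le (ENNReal.div_le_of_le_mul ?_) (tsub_le_iff_right.2 ?_)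
  · rw [edist_dist, edist_dist, ← ENNReal.ofReal_ofNat, ← ENNReal.ofReal_mul dist_nonneg]
    exact ENNReal.ofReal_le_ofReal (by linarith)
  · rw [edist_dist, edist_dist, ← ENNReal.ofReal_add dist_nonneg (by linarith)]
    exact ENNReal.ofReal_le_ofReal (by linarith)

variable [MeasurableSpace X]

/-- Open sets `W j` in balls `B(x_j, r_j)`, whose `t`-energies are controlled by the measures of
the balls, where the limsup set of the balls has full measure for a doubling measure `ν`. -/
structure IsEnergySystem (ν : Measure X) (t : ℝ) (x : ℕ → X) (r : ℕ → ℝ) (W : ℕ → Set X) :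
    Prop where
  doubling : ∃ C : ℝ≥0∞, C ≠ ∞ ∧ ∀ c : X, ∀ ρ : ℝ, 0 < ρ →
    ν (Metric.closedBall c (13 * ρ)) ≤ C * ν (Metric.ball c ρ)
  tendsto_radius : Tendsto r atTop (𝓝 0)
  radius_pos : ∀ j, 0 < r j
  full : ν (limsup (fun j => Metric.ball (x j) (r j)) atTop)ᶜ = 0
  isOpen : ∀ j, IsOpen (W j)
  closure_subset : ∀ j, closure (W j) ⊆ Metric.ball (x j) (r j)
  measure_ne_zero : ∀ j, ν (W j) ≠ 0
  energy : ∃ K : ℝ≥0∞, K ≠ ∞ ∧ ∀ j, mutualEnergy t (ν.restrict (W j)) (ν.restrict (W j)) *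
    ν (Metric.ball (x j) (r j)) ≤ K * ν (W j) ^ 2

/-- A measure `μ` of bounded density with respect to `ν`, living on the open set `V`, of mass more
than `a` and `τ`-energy less than `b`, giving mass less than `β i` to `Z i` for `i ∈ F`. -/
structure IsMassBound {ι : Type*} (ν : Measure X) (τ : ℝ) (a b : ℝ≥0∞) (F : Finset ι)
    (Z : ι → Set X) (β : ι → ℝ≥0∞) (V : Set X) (μ : Measure X) : Prop where
  isOpen : IsOpen V
  density : ∃ L : ℝ≥0∞, L ≠ ∞ ∧ μ ≤ L • ν
  compl : μ Vᶜ = 0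
  mass : a < μ univ
  energy : mutualEnergy τ μ μ < b
  measure_lt : ∀ i ∈ F, μ (Z i) < β i

variable [CompactSpace X] [BorelSpace X] {ν : Measure X} [IsFiniteMeasure ν]
  {t τ : ℝ} {x : ℕ → X} {r : ℕ → ℝ} {W : ℕ → Set X}
  {ι : Type*} {a b : ℝ≥0∞} {F : Finset ι} {Z : ι → Set X} {β : ι → ℝ≥0∞}

theorem IsMassBound.exists_next (hS : IsEnergySystem ν t x r W) (hτ : 0 < τ) (hτt : τ < t)
    (hZ : ∀ i, IsClosed (Z i)) {V : Set X} {μ : Measure X}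
    (h : IsMassBound ν τ a b F Z β V μ) (k : ℕ) :
    ∃ V' μ', IsMassBound ν τ a b F Z β V' μ' ∧ closure V' ⊆ V ∩ ⋃ j ≥ k, closure (W j) := by
  obtain ⟨C, hC, hdoub⟩ := hS.doubling
  obtain ⟨K, hK, hen⟩ := hS.energy
  obtain ⟨L, hL, hμL⟩ := h.density
  have hac : μ ≪ ν := (Measure.absolutelyContinuous_of_le hμL).trans
    Measure.smul_absolutelyContinuous
  have : IsFiniteMeasure μ := ⟨(hμL univ).trans_lt
    (ENNReal.mul_lt_top hL.lt_top (measure_lt_top ν univ))⟩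
  have hWm : ∀ j, MeasurableSet (W j) := fun j => (hS.isOpen j).measurableSet
  set P : ℕ → Set X := fun j => Metric.closedBall (x j) (3 * r j) with hP
  have hPm : ∀ j, MeasurableSet (P j) := fun j => Metric.isClosed_closedBall.measurableSet
  -- Diagonal cost per unit of mass at scale δ. It depends on the density bound `L` of the current
  -- measure, so δ is chosen after `μ`; τ < t makes it tend to 0.
  set D : ℝ → ℝ≥0∞ := fun δ => ENNReal.ofReal (2 * δ) ^ (t - τ) * (K * (L * C)) with hD
  have hlim1 : Tendsto (fun δ => ∫⁻ p, perturbedKernel τ δ p ∂(μ.prod μ) + D δ * μ univ) (𝓝[>] 0)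
      (𝓝 (mutualEnergy τ μ μ)) := by
    have hc : Tendsto (fun δ : ℝ => ENNReal.ofReal (2 * δ) ^ (t - τ)) (𝓝[>] 0) (𝓝 0) := by
      have hcont : Continuous fun δ : ℝ => ENNReal.ofReal (2 * δ) ^ (t - τ) :=
        ENNReal.continuous_rpow_const.comp
          (ENNReal.continuous_ofReal.comp (continuous_const.mul continuous_id))
      have := (hcont.tendsto 0).mono_left (nhdsWithin_le_nhds (s := Ioi 0))
      simpa [ENNReal.zero_rpow_of_pos (sub_pos.2 hτt)] using this
    have hc2 : Tendsto (fun δ : ℝ => D δ * μ univ) (𝓝[>] 0) (𝓝 0) := by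
      have := ENNReal.Tendsto.mul_const (b := K * (L * C) * μ univ) hc
        (.inr (ENNReal.mul_ne_top (ENNReal.mul_ne_top hK (ENNReal.mul_ne_top hL hC))
          (measure_ne_top _ _)))
      simpa [hD, mul_assoc] using this
    simpa using (tendsto_lintegral_perturbedKernel hτ μ (h.energy.trans_le le_top).ne).add hc2
  have hlim2 : ∀ i ∈ F, ∀ᶠ δ : ℝ in 𝓝[>] 0, μ (Metric.cthickening (4 * δ) (Z i)) < β i := by
    intro i hi
    have h1 := tendsto_measure_cthickening_of_isClosed (μ := μ) (s := Z i)
      ⟨1, one_pos, measure_ne_top _ _⟩ (hZ i)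
    have h2 : Tendsto (fun δ : ℝ => 4 * δ) (𝓝[>] 0) (𝓝 0) := by
      have : Continuous fun δ : ℝ => 4 * δ := by fun_prop
      simpa using (this.tendsto 0).mono_left (nhdsWithin_le_nhds (s := Ioi 0))
    exact (h1.comp h2).eventually_lt_const (h.measure_lt i hi)
  obtain ⟨δ, ⟨hδ1, hδ2⟩, hδ0⟩ := ((hlim1.eventually_lt_const h.energy).and
    ((Filter.eventually_all_finset F).2 hlim2)).and self_mem_nhdsWithin |>.exists
  obtain ⟨J, hJ, hd, hJa⟩ := exists_finset_pairwiseDisjoint_closedBall hC hdoub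
    hS.tendsto_radius hS.radius_pos hS.full hac h.isOpen h.compl h.mass k hδ0
  have hWB : ∀ j, W j ⊆ Metric.ball (x j) (r j) := fun j =>
    subset_closure.trans (hS.closure_subset j)
  have hB0 : ∀ j, ν (Metric.ball (x j) (r j)) ≠ 0 := fun j h0 =>
    hS.measure_ne_zero j (measure_mono_null (hWB j) h0)
  refine ⟨⋃ j ∈ J, W j, redistribute μ ν P W J, ⟨isOpen_biUnion fun j _ => hS.isOpen j,
    exists_redistribute_le_smul hS.measure_ne_zero, redistribute_compl_eq_zero hWm, ?_, ?_, ?_⟩, ?_⟩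
  · rwa [redistribute_univ hS.measure_ne_zero]
  · refine (mutualEnergy_redistribute_le hS.measure_ne_zero hWm hPm hd
      (measurable_perturbedKernel τ δ) ?_ (D := D δ) ?_).trans_lt hδ1
    · intro i hi j hj hij y hy x hx y' hy' x' hx'
      exact edist_rpow_neg_le_perturbedKernel hτ (hd hi hj hij) (hJ i hi).2.1 (hJ j hj).2.1
        (hWB i hy) (hWB j hx) hy' hx'
    · intro j hj
      set c := μ (P j) / ν (W j) with hc
      set E := mutualEnergy t (ν.restrict (W j)) (ν.restrict (W j)) with hE
      have hcW : c * ν (W j) = μ (P j) :=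
        ENNReal.div_mul_cancel (hS.measure_ne_zero j) (measure_ne_top _ _)
      have hPB : μ (P j) ≤ L * C * ν (Metric.ball (x j) (r j)) := by
        calc μ (P j) ≤ L * ν (P j) := hμL _
          _ ≤ L * ν (Metric.closedBall (x j) (13 * r j)) := by
            gcongr
            exact Metric.closedBall_subset_closedBall (by linarith [hS.radius_pos j])
          _ ≤ L * (C * ν (Metric.ball (x j) (r j))) := by
            gcongr
            exact hdoub _ _ (hS.radius_pos j)
          _ = _ := by ring
      -- After multiplication by ν(B_j), the energy hypothesis turns c²E ν(B_j) into K μ(P_j)²; one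
      -- factor μ(P_j) is then traded for LC ν(B_j), which cancels.
      have hcc : c * c * E ≤ K * (L * C) * μ (P j) := by
        rw [← ENNReal.mul_le_mul_iff_left (hB0 j) (measure_ne_top ν _)]
        calc c * c * E * ν (Metric.ball (x j) (r j))
            = c * c * (E * ν (Metric.ball (x j) (r j))) := by ring
          _ ≤ c * c * (K * ν (W j) ^ 2) := mul_le_mul_right (hen j) _
          _ = K * (c * ν (W j)) * (c * ν (W j)) := by ring
          _ = K * μ (P j) * μ (P j) := by rw [hcW]
          _ ≤ K * μ (P j) * (L * C * ν (Metric.ball (x j) (r j))) := by gcongr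
          _ = _ := by ring
      have hdiam : mutualEnergy τ (ν.restrict (W j)) (ν.restrict (W j)) ≤
          ENNReal.ofReal (2 * δ) ^ (t - τ) * E :=
        mutualEnergy_restrict_le_of_lt hτ hτt (by linarith) ν (hWm j) fun y hy z hz => by
          have h1 := Metric.mem_ball.1 (hWB j hy)
          have h2 := Metric.mem_ball.1 (hWB j hz)
          have h3 := dist_triangle_right y z (x j)
          linarith [(hJ j hj).2.1]
      calc _ ≤ c * (c * (ENNReal.ofReal (2 * δ) ^ (t - τ) * E)) := by gcongr
        _ = ENNReal.ofReal (2 * δ) ^ (t - τ) * (c * c * E) := by ring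
        _ ≤ ENNReal.ofReal (2 * δ) ^ (t - τ) * (K * (L * C) * μ (P j)) := by gcongr
        _ = _ := by simp only [hD]; ring
  · intro i hi
    refine (redistribute_le_of_subset hS.measure_ne_zero hPm hd (hZ i).measurableSet ?_).trans_lt
      (hδ2 i hi)
    rintro j hj ⟨z, hz, hzW⟩ p hp
    -- Here 4δ = 3δ + δ: `p` lies in the triple ball and `z` in the ball itself.
    refine Metric.mem_cthickening_of_dist_le p z _ _ hz ?_
    have h1 := Metric.mem_ball.1 (hWB j hzW)
    have h2 := Metric.mem_closedBall.1 hp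
    have h3 := dist_triangle_right p z (x j)
    linarith [(hJ j hj).2.1]
  · rw [J.closure_biUnion]
    refine iUnion₂_subset fun j hj => subset_inter ?_ ?_
    · exact ((hS.closure_subset j).trans Metric.ball_subset_closedBall).trans
        ((Metric.closedBall_subset_closedBall (by linarith [hS.radius_pos j])).trans (hJ j hj).2.2)
    · exact subset_biUnion_of_mem (u := fun j => closure (W j)) (hJ j hj).1

/-- Iterating the redistribution yields measures living on any open neighbourhood of the part in
`V` of the limsup set. -/
theorem IsMassBound.exists_of_limsup_subset (hS : IsEnergySystem ν t x r W) (hτ : 0 < τ)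
    (hτt : τ < t) (hZ : ∀ i, IsClosed (Z i)) {V : Set X} {μ : Measure X}
    (h : IsMassBound ν τ a b F Z β V μ) {O : Set X} (hO : IsOpen O)
    (hVO : V ∩ limsup (fun j => closure (W j)) atTop ⊆ O) :
    ∃ V' μ', IsMassBound ν τ a b F Z β V' μ' ∧ V' ⊆ O := by
  choose! N M hN using fun (k : ℕ) (q : Set X × Measure X)
    (hq : IsMassBound ν τ a b F Z β q.1 q.2) => hq.exists_next hS hτ hτt hZ k
  let s : ℕ → Set X × Measure X := fun n =>
    Nat.rec (V, μ) (fun k q => (N k q, M k q)) n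
  have hs : ∀ n, IsMassBound ν τ a b F Z β (s n).1 (s n).2 := by
    intro n
    induction n with
    | zero => exact h
    | succ k ih => exact (hN k (s k) ih).1
  have hs' : ∀ n, closure (s (n + 1)).1 ⊆ (s n).1 ∩ ⋃ j ≥ n, closure (W j) := fun n =>
    (hN n (s n) (hs n)).2
  have hanti : Antitone fun n => (s n).1 :=
    antitone_nat_of_succ_le fun n => subset_closure.trans ((hs' n).trans inter_subset_left)
  by_contra! hcon
  -- If no stage lies in `O`, nested compactness yields a point outside `O` common to all closures;
  -- it lies in `V` and in closure(W_j) for arbitrarily large j, contradicting `hVO`.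
  have hne : (⋂ n, closure (s (n + 1)).1 ∩ Oᶜ).Nonempty := by
    refine IsCompact.nonempty_iInter_of_sequence_nonempty_isCompact_isClosed _ (fun n => ?_)
      (fun n => ?_) ?_ fun n => ?_
    · exact inter_subset_inter_left _ (closure_mono (hanti (Nat.le_succ _)))
    · obtain ⟨z, hz, hzO⟩ := not_subset.1 (hcon _ _ (hs (n + 1)))
      exact ⟨z, subset_closure hz, hzO⟩
    · exact (isClosed_closure.inter hO.isClosed_compl).isCompact
    · exact isClosed_closure.inter hO.isClosed_compl
  obtain ⟨z, hz⟩ := hne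
  rw [mem_iInter] at hz
  refine (hz 0).2 (hVO ⟨(hs' 0 (hz 0).1).1, ?_⟩)
  rw [mem_limsup_iff_frequently_mem, frequently_atTop]
  intro n
  obtain ⟨j, hj⟩ := mem_iUnion.1 (hs' n (hz n).1).2
  obtain ⟨hjn, hj⟩ := mem_iUnion.1 hj
  exact ⟨j, hjn, hj⟩

end Transference

/-! ### Covers of the limsup set -/

section Covers

variable {X : Type*} [MetricSpace X]

/-- Any set has a small open thickening of almost the same power of the diameter. -/
theorem eventually_ediam_thickening_rpow_le {τ : ℝ} (hτ : 0 < τ) (S : Set X) {ε : ℝ≥0∞}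
    (hε : ε ≠ 0) :
    ∀ᶠ η : ℝ in 𝓝[>] 0, Metric.ediam (Metric.thickening η S) ^ τ ≤ Metric.ediam S ^ τ + ε := by
  rcases eq_or_ne (Metric.ediam S ^ τ) ∞ with htop | htop
  · simp [htop]
  have hcont : Continuous fun η : ℝ => (Metric.ediam S + 2 * ENNReal.ofReal η) ^ τ :=
    ENNReal.continuous_rpow_const.comp (continuous_const.add
      ((ENNReal.continuous_const_mul (by simp)).comp ENNReal.continuous_ofReal))
  have h0 := (hcont.tendsto 0).mono_left (nhdsWithin_le_nhds (s := Ioi 0))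
  simp only [ENNReal.ofReal_zero, mul_zero, add_zero] at h0
  filter_upwards [h0.eventually_lt_const (ENNReal.lt_add_right htop hε), self_mem_nhdsWithin]
    with η hη hη0
  refine le_trans ?_ hη.le
  gcongr
  have := Metric.ediam_thickening_le (s := S) η.toNNReal
  rwa [Real.coe_toNNReal _ (le_of_lt hη0)] at this

variable [CompactSpace X] [MeasurableSpace X] [BorelSpace X]
  {ν : Measure X} [IsFiniteMeasure ν] {t τ : ℝ} {x : ℕ → X} {r : ℕ → ℝ} {W : ℕ → Set X}

/-- A countable family of sets with finite `∑ |S_i|^τ` covering the part of the limsup set in `V`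
must cover `V` in measure. -/
theorem IsEnergySystem.measure_le_tsum_closure (hS : IsEnergySystem ν t x r W) (hτ : 0 < τ)
    (hτt : τ < t) {V : Set X} (hV : IsOpen V)
    (hfin : mutualEnergy τ (ν.restrict V) (ν.restrict V) ≠ ∞)
    {ι : Type*} [Countable ι] (S : ι → Set X) (hsum : ∑' i, Metric.ediam (S i) ^ τ ≠ ∞)
    (hcov : V ∩ limsup (fun j => closure (W j)) atTop ⊆ ⋃ i, S i) :
    ν V ≤ ∑' i, ν (closure (S i)) := by
  classical
  by_contra! hlt
  obtain ⟨a, hAa, haV⟩ := exists_between hlt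
  set A := ∑' i, ν (closure (S i)) with hA
  set b := mutualEnergy τ (ν.restrict V) (ν.restrict V) + 1 with hb
  have hb1 : mutualEnergy τ (ν.restrict V) (ν.restrict V) < b :=
    ENNReal.lt_add_right hfin one_ne_zero
  have hbtop : b ≠ ∞ := by simp [hb, hfin]
  have hb0 : b ≠ 0 := (zero_le.trans_lt hb1).ne'
  have hAtop : A ≠ ∞ := (hAa.trans_le le_top).ne
  have hatop : a ≠ ∞ := (haV.trans_le le_top).ne
  -- Of the four ε, one is for the finitely many sets in `F` and three for the rest: κb = ε from the
  -- energy, and κ⁻¹(κε + κε) = 2ε from the diameters.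
  set ε := (a - A) / 4 with hε
  have hε0 : ε ≠ 0 := by simp [hε, tsub_eq_zero_iff_le, hAa]
  have hεtop : ε ≠ ∞ := ENNReal.div_ne_top (ENNReal.sub_ne_top hatop) (by norm_num)
  have hAε : A + 4 * ε ≤ a := by
    rw [hε, ENNReal.mul_div_cancel (by norm_num) (by norm_num), add_tsub_cancel_of_le hAa.le]
  set κ := ε / b with hκ
  have hκ0 : κ ≠ 0 := by simp [hκ, hε0, hbtop]
  have hκtop : κ ≠ ∞ := ENNReal.div_ne_top hεtop hb0
  have hκb : κ * b = ε := ENNReal.div_mul_cancel hb0 hbtop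
  have hκε : κ * ε ≠ 0 := mul_ne_zero hκ0 hε0
  -- The energy bound `b`, hence κ, is fixed before `F`; so the tail can be made small relative to
  -- κ, while the masses of the finitely many remaining sets are tracked through the iteration.
  obtain ⟨F, hF⟩ := ((ENNReal.tendsto_tsum_compl_atTop_zero hsum).eventually_lt_const
    (pos_iff_ne_zero.2 hκε)).exists
  obtain ⟨e, he0, heε⟩ := ENNReal.exists_pos_sum_of_countable (ε := min ε (κ * ε))
    (by simp [hε0, hκ0]) ι
  have hη : ∀ i, ∃ η : ℝ, 0 < η ∧ ν (Metric.cthickening η (S i)) < ν (closure (S i)) + e i ∧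
      Metric.ediam (Metric.thickening η (S i)) ^ τ ≤ Metric.ediam (S i) ^ τ + e i := by
    intro i
    have he : (e i : ℝ≥0∞) ≠ 0 := by simp [(he0 i).ne']
    have h1 := (tendsto_measure_cthickening (μ := ν) (s := S i)
      ⟨1, one_pos, measure_ne_top _ _⟩).mono_left (nhdsWithin_le_nhds (s := Ioi 0))
    obtain ⟨η, ⟨h2, h3⟩, h4⟩ := ((h1.eventually_lt_const
      (ENNReal.lt_add_right (measure_ne_top ν _) he)).and
      (eventually_ediam_thickening_rpow_le hτ (S i) he)).and self_mem_nhdsWithin |>.exists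
    exact ⟨η, h4, h2, h3⟩
  choose η hη0 hην hηd using hη
  have hstart : IsMassBound ν τ a b F (fun i => Metric.cthickening (η i) (S i))
      (fun i => ν (closure (S i)) + e i) V (ν.restrict V) :=
    ⟨hV, ⟨1, ENNReal.one_ne_top, by rw [one_smul]; exact Measure.restrict_le_self⟩,
      by simp [Measure.restrict_apply hV.measurableSet.compl], by simpa using haV, hb1,
      fun i _ => (Measure.restrict_apply_le _ _).trans_lt (hην i)⟩
  obtain ⟨V', μ, hμ, hV'⟩ := hstart.exists_of_limsup_subset hS hτ hτt
    (fun i => Metric.isClosed_cthickening)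
    (isOpen_iUnion fun i => Metric.isOpen_thickening (δ := η i) (E := S i))
    (hcov.trans (iUnion_mono fun i => Metric.self_subset_thickening (hη0 i) _))
  obtain ⟨L, hL, hμL⟩ := hμ.density
  have : IsFiniteMeasure μ := ⟨(hμL univ).trans_lt
    (ENNReal.mul_lt_top hL.lt_top (measure_lt_top ν univ))⟩
  have hbig : ∑ i ∈ F, μ (Metric.cthickening (η i) (S i)) ≤ A + ε := by
    calc _ ≤ ∑ i ∈ F, (ν (closure (S i)) + e i) :=
          Finset.sum_le_sum fun i hi => (hμ.measure_lt i hi).le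
      _ ≤ ∑' i, (ν (closure (S i)) + e i) := ENNReal.sum_le_tsum _
      _ = A + ∑' i, (e i : ℝ≥0∞) := ENNReal.tsum_add
      _ ≤ A + ε := by gcongr; exact heε.le.trans (min_le_left _ _)
  have hsmall : μ (⋃ i : {i // i ∉ F}, Metric.thickening (η i) (S i)) ≤ 3 * ε := by
    calc _ ≤ κ * mutualEnergy τ μ μ +
          κ⁻¹ * ∑' i : {i // i ∉ F}, Metric.ediam (Metric.thickening (η i) (S i)) ^ τ :=
          measure_iUnion_le_energy hτ μ _ hκ0 hκtop
      _ ≤ κ * b + κ⁻¹ * (κ * ε + κ * ε) := by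
          gcongr
          · exact hμ.energy.le
          · calc _ ≤ ∑' i : {i // i ∉ F}, (Metric.ediam (S i) ^ τ + e i) :=
                  ENNReal.tsum_le_tsum fun i => hηd i
              _ = ∑' i : {i // i ∉ F}, Metric.ediam (S i) ^ τ +
                  ∑' i : {i // i ∉ F}, (e i : ℝ≥0∞) := ENNReal.tsum_add
              _ ≤ _ := by
                  refine add_le_add hF.le ?_
                  exact (ENNReal.tsum_comp_le_tsum_of_injective Subtype.val_injective _).trans
                    (heε.le.trans (min_le_right _ _))
      _ = 3 * ε := by
          rw [hκb, ← mul_add, ← mul_assoc, ENNReal.inv_mul_cancel hκ0 hκtop]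
          ring
  have hcover : μ univ ≤ ∑ i ∈ F, μ (Metric.cthickening (η i) (S i)) +
      μ (⋃ i : {i // i ∉ F}, Metric.thickening (η i) (S i)) := by
    calc μ univ ≤ μ (V'ᶜ ∪ ((⋃ i ∈ F, Metric.cthickening (η i) (S i)) ∪
          ⋃ i : {i // i ∉ F}, Metric.thickening (η i) (S i))) := by
          refine measure_mono fun y _ => ?_
          by_cases hy : y ∈ V'
          · obtain ⟨i, hi⟩ := mem_iUnion.1 (hV' hy)
            by_cases hiF : i ∈ F
            · exact .inr (.inl (mem_biUnion hiF (Metric.thickening_subset_cthickening _ _ hi)))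
            · exact .inr (.inr (mem_iUnion.2 ⟨⟨i, hiF⟩, hi⟩))
          · exact .inl hy
      _ ≤ 0 + _ := (measure_union_le _ _).trans (by
          rw [hμ.compl]
          gcongr
          exact (measure_union_le _ _).trans (by gcongr; exact measure_biUnion_finset_le _ _))
      _ = _ := zero_add _
  refine absurd hμ.mass (not_lt.2 (hcover.trans ((add_le_add hbig hsmall).trans ?_)))
  calc A + ε + 3 * ε = A + 4 * ε := by ring
    _ ≤ a := hAε

/-- An open set of positive measure contains the closure of an open set of at least half its
measure. -/
theorem exists_isOpen_closure_subset_measure_le {U : Set X} (hU : IsOpen U) (hU0 : ν U ≠ 0) :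
    ∃ W : Set X, IsOpen W ∧ closure W ⊆ U ∧ ν U ≤ 2 * ν W ∧ ν W ≠ 0 := by
  obtain ⟨K, hKU, hK, hνK⟩ := hU.exists_lt_isCompact
    (ENNReal.half_lt_self hU0 (measure_ne_top ν U))
  obtain ⟨W, hW, hKW, hWU, -⟩ := exists_open_between_and_isCompact_closure hK hU hKU
  have h : ν U / 2 < ν W := hνK.trans_le (measure_mono hKW)
  refine ⟨W, hW, hWU, ?_, (zero_le.trans_lt h).ne'⟩
  rw [mul_comm]
  exact (ENNReal.div_le_iff (by norm_num) (by norm_num)).1 h.le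

/-- The hypotheses on open sets `U j` give an energy system of smaller sets `W j` whose closures
lie in `U j`. -/
theorem exists_isEnergySystem [ν.IsOpenPosMeasure] {U : ℕ → Set X}
    (hdoub : ∃ C : ℝ≥0∞, C ≠ ∞ ∧ ∀ c : X, ∀ ρ : ℝ, 0 < ρ →
      ν (Metric.closedBall c (13 * ρ)) ≤ C * ν (Metric.ball c ρ))
    (hr : Tendsto r atTop (𝓝 0)) (hUo : ∀ j, IsOpen (U j)) (hUne : ∀ j, (U j).Nonempty)
    (hUB : ∀ j, U j ⊆ Metric.ball (x j) (r j))
    (hfull : ν (limsup (fun j => Metric.ball (x j) (r j)) atTop)ᶜ = 0)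
    (hK : ⨆ j, mutualEnergy t (ν.restrict (U j)) (ν.restrict (U j)) *
      ν (Metric.ball (x j) (r j)) / ν (U j) ^ 2 < ∞) :
    ∃ W : ℕ → Set X, IsEnergySystem ν t x r W ∧ ∀ j, closure (W j) ⊆ U j := by
  have hU0 : ∀ j, ν (U j) ≠ 0 := fun j => ((hUo j).measure_pos ν (hUne j)).ne'
  choose W hWo hWU hW2 hW0 using fun j =>
    exists_isOpen_closure_subset_measure_le (hUo j) (hU0 j)
  refine ⟨W, ⟨hdoub, hr, fun j => ?_, hfull, hWo, fun j => (hWU j).trans (hUB j), hW0,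
    -- The 4 is the square of the factor 2 lost in the measure of `W j`.
    ⟨_, ENNReal.mul_ne_top hK.ne (by norm_num : (4 : ℝ≥0∞) ≠ ∞), fun j => ?_⟩⟩, hWU⟩
  · obtain ⟨y, hy⟩ := hUne j
    exact Metric.pos_of_mem_ball (hUB j hy)
  · have hmono := Measure.restrict_mono (subset_closure.trans (hWU j)) (le_refl ν)
    have hj := le_iSup (fun j => mutualEnergy t (ν.restrict (U j)) (ν.restrict (U j)) *
      ν (Metric.ball (x j) (r j)) / ν (U j) ^ 2) j
    rw [ENNReal.div_le_iff (pow_ne_zero _ (hU0 j)) (ENNReal.pow_ne_top (measure_ne_top _ _))] at hj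
    calc _ ≤ mutualEnergy t (ν.restrict (U j)) (ν.restrict (U j)) *
          ν (Metric.ball (x j) (r j)) := mul_le_mul_left (mutualEnergy_mono hmono hmono) _
      _ ≤ _ := hj
      _ ≤ _ * (2 * ν (W j)) ^ 2 := by gcongr; exact hW2 j
      _ = _ := by ring

end Covers

/-! ### Lebesgue measure on the torus: doubling and finite energy -/

section TorusMeasure

variable {d : ℕ}

instance instCompactSpaceTorus : CompactSpace (Torus d) :=
  (PiLp.homeomorph 2 (fun _ : Fin d => UnitAddCircle)).symm.compactSpace

theorem lebesgueTorus_box (A : Fin d → Set UnitAddCircle) :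
    lebesgueTorus d {x | ∀ i, x i ∈ A i} = ∏ i, volume (A i) := by
  have h := (MeasurableEquiv.toLp 2 (Fin d → UnitAddCircle)).map_apply
    (μ := (volume : Measure (UnitAddTorus (Fin d)))) {x | ∀ i, x i ∈ A i}
  rw [MeasurableEquiv.coe_toLp] at h
  rw [lebesgueTorus, h, ← volume_pi_pi]
  congr 1
  ext y
  simp

instance instIsProbabilityMeasureLebesgueTorus : IsProbabilityMeasure (lebesgueTorus d) := by
  constructor
  have := lebesgueTorus_box (d := d) fun _ => univ
  simpa using this

instance instIsOpenPosMeasureLebesgueTorus : (lebesgueTorus d).IsOpenPosMeasure :=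
  (PiLp.continuous_toLp 2 (fun _ : Fin d => UnitAddCircle)).isOpenPosMeasure_map
    (WithLp.toLp_surjective 2)

theorem lebesgueTorus_box_closedBall (c : Torus d) (ρ : ℝ) :
    lebesgueTorus d {x | ∀ i, x i ∈ Metric.closedBall (c i) ρ} =
      ENNReal.ofReal (min 1 (2 * ρ)) ^ d := by
  rw [lebesgueTorus_box]
  simp [AddCircle.volume_closedBall]

theorem Torus.dist_apply_le (x y : Torus d) (i : Fin d) : dist (x i) (y i) ≤ dist x y := by
  rw [PiLp.dist_eq_of_L2]
  refine Real.le_sqrt_of_sq_le ?_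
  exact Finset.single_le_sum (f := fun i => dist (x i) (y i) ^ 2) (fun _ _ => sq_nonneg _)
    (Finset.mem_univ i)

theorem Torus.dist_le_sqrt_mul {x y : Torus d} {ρ : ℝ} (hρ : 0 ≤ ρ)
    (h : ∀ i, dist (x i) (y i) ≤ ρ) : dist x y ≤ √d * ρ := by
  rw [PiLp.dist_eq_of_L2]
  calc √(∑ i, dist (x i) (y i) ^ 2) ≤ √(∑ _i : Fin d, ρ ^ 2) := by
        gcongr with i; exact h i
    _ = √d * ρ := by simp [Real.sqrt_mul, Real.sqrt_sq hρ]

theorem lebesgueTorus_closedBall_le (c : Torus d) (ρ : ℝ) :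
    lebesgueTorus d (Metric.closedBall c ρ) ≤ ENNReal.ofReal (min 1 (2 * ρ)) ^ d := by
  rw [← lebesgueTorus_box_closedBall c ρ]
  refine measure_mono fun x hx i => ?_
  exact (Torus.dist_apply_le x c i).trans hx

/-- Since √d < d + 1, the closed box of half-side ρ/(d + 1) fits into the open ball, also when d =
0. -/
theorem le_lebesgueTorus_ball (c : Torus d) {ρ : ℝ} (hρ : 0 < ρ) :
    ENNReal.ofReal (min 1 (2 * (ρ / (d + 1)))) ^ d ≤ lebesgueTorus d (Metric.ball c ρ) := by
  rw [← lebesgueTorus_box_closedBall c]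
  refine measure_mono fun x hx => ?_
  refine (Torus.dist_le_sqrt_mul (by positivity) hx).trans_lt ?_
  have h : √(d : ℝ) < d + 1 := by
    rw [Real.sqrt_lt' (by positivity)]
    nlinarith [(Nat.cast_nonneg d : (0 : ℝ) ≤ d)]
  rw [mul_div_assoc', div_lt_iff₀ (by positivity), mul_comm]
  gcongr

theorem lebesgueTorus_doubling :
    ∃ C : ℝ≥0∞, C ≠ ∞ ∧ ∀ c : Torus d, ∀ ρ : ℝ, 0 < ρ →
      lebesgueTorus d (Metric.closedBall c (13 * ρ)) ≤ C * lebesgueTorus d (Metric.ball c ρ) := by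
  refine ⟨ENNReal.ofReal (13 * (d + 1)) ^ d, ENNReal.pow_ne_top ENNReal.ofReal_ne_top,
    fun c ρ hρ => ?_⟩
  calc _ ≤ ENNReal.ofReal (min 1 (2 * (13 * ρ))) ^ d := lebesgueTorus_closedBall_le _ _
    _ ≤ (ENNReal.ofReal (13 * (d + 1)) * ENNReal.ofReal (min 1 (2 * (ρ / (d + 1))))) ^ d := by
      rw [← ENNReal.ofReal_mul (by positivity)]
      gcongr
      rw [mul_min_of_nonneg _ _ (by positivity)]
      refine min_le_min (by linarith [(Nat.cast_nonneg d : (0 : ℝ) ≤ d)]) (le_of_eq ?_)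
      field_simp
    _ ≤ _ := by
      rw [mul_pow]
      gcongr
      exact le_lebesgueTorus_ball c hρ

theorem lebesgueTorus_closure_le_ediam (S : Set (Torus d)) :
    lebesgueTorus d (closure S) ≤ 2 ^ d * Metric.ediam S ^ d := by
  rcases S.eq_empty_or_nonempty with rfl | ⟨y, hy⟩
  · simp
  have hb : Bornology.IsBounded S := (isCompact_univ.isBounded).subset (subset_univ S)
  calc lebesgueTorus d (closure S) ≤ lebesgueTorus d (Metric.closedBall y (Metric.diam S)) :=
        measure_mono (closure_minimal (fun x hx => Metric.dist_le_diam_of_mem hb hx hy)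
          Metric.isClosed_closedBall)
    _ ≤ ENNReal.ofReal (min 1 (2 * Metric.diam S)) ^ d := lebesgueTorus_closedBall_le _ _
    _ ≤ ENNReal.ofReal (2 * Metric.diam S) ^ d := by gcongr; exact min_le_right _ _
    _ = _ := by
      rw [ENNReal.ofReal_mul (by norm_num), mul_pow, Metric.diam,
        ENNReal.ofReal_toReal hb.ediam_ne_top]
      simp

/-- Riesz potentials of Lebesgue measure on the torus are bounded for exponents less than `d`. -/
theorem exists_riesz_potential_le {τ : ℝ} (hτ : 0 < τ) (hτd : τ < d) :
    ∃ M : ℝ≥0∞, M ≠ ∞ ∧ ∀ y : Torus d, ∫⁻ x, edist x y ^ (-τ) ∂(lebesgueTorus d) ≤ M := by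
  set q : ℝ≥0∞ := 2⁻¹ with hq
  have hq0 : q ≠ 0 := by simp [hq]
  have hqtop : q ≠ ∞ := by simp [hq]
  have hq1 : q < 1 := by simp [hq, ENNReal.inv_lt_one]
  have hqr : ∀ k : ℕ, ENNReal.ofReal ((1 / 2 : ℝ) ^ k) = q ^ k := fun k => by
    rw [ENNReal.ofReal_pow (by norm_num), one_div, ENNReal.ofReal_inv_of_pos (by norm_num), hq]
    simp
  have hgeom : ∑' k : ℕ, (q ^ (k + 1)) ^ (-τ) * (2 * q ^ k) ^ d ≠ ∞ := by
    have hterm : ∀ k : ℕ, (q ^ (k + 1)) ^ (-τ) * (2 * q ^ k) ^ d =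
        q ^ (-τ) * 2 ^ d * (q ^ (d - τ)) ^ k := by
      intro k
      have e1 : (q ^ (k + 1)) ^ (-τ) = q ^ (-τ) * q ^ (-τ * k) := by
        rw [← ENNReal.rpow_natCast, ← ENNReal.rpow_mul, ← ENNReal.rpow_add _ _ hq0 hqtop]
        congr 1; push_cast; ring
      have e2 : (2 * q ^ k) ^ d = 2 ^ d * q ^ ((d : ℝ) * k) := by
        rw [mul_pow, ← pow_mul, ← ENNReal.rpow_natCast q]
        congr 2; push_cast; ring
      have e3 : (q ^ ((d : ℝ) - τ)) ^ k = q ^ (-τ * k) * q ^ ((d : ℝ) * k) := by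
        rw [← ENNReal.rpow_natCast, ← ENNReal.rpow_mul, ← ENNReal.rpow_add _ _ hq0 hqtop]
        congr 1; ring
      rw [e1, e2, e3]; ring
    simp_rw [hterm]
    rw [ENNReal.tsum_mul_left, ENNReal.tsum_geometric]
    refine ENNReal.mul_ne_top (ENNReal.mul_ne_top ?_ (by simp)) ?_
    · rw [ENNReal.rpow_neg]; simp [hq0, hqtop]
    · rw [ENNReal.inv_ne_top]
      exact (tsub_pos_of_lt (ENNReal.rpow_lt_one hq1 (by linarith))).ne'
  refine ⟨1 + ∑' k : ℕ, (q ^ (k + 1)) ^ (-τ) * (2 * q ^ k) ^ d, by simp [hgeom], fun y => ?_⟩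
  -- For 2^(-k-1) < |x - y| ≤ 2^(-k) the k-th term dominates the kernel, and distances above 1 are
  -- covered by the summand 1. The integrals form a geometric series of ratio 2^(-(d - τ)).
  set f : ℕ → Torus d → ℝ≥0∞ := fun k =>
    (Metric.closedBall y ((1 / 2 : ℝ) ^ k)).indicator fun _ => (q ^ (k + 1)) ^ (-τ) with hf
  have hfm : ∀ k, Measurable (f k) := fun k =>
    measurable_const.indicator Metric.isClosed_closedBall.measurableSet
  have hpt : ∀ x, edist x y ^ (-τ) ≤ 1 + ∑' k, f k x := by
    intro x
    rcases eq_or_ne x y with rfl | hne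
    · have h1 : ∀ k, 1 ≤ f k x := fun k => by
        rw [hf]
        dsimp only
        rw [indicator_of_mem (Metric.mem_closedBall_self (by positivity)), ENNReal.rpow_neg,
          ENNReal.one_le_inv]
        exact ENNReal.rpow_le_one (pow_le_one₀ zero_le hq1.le) hτ.le
      have h2 : ∑' k, f k x = ∞ := by
        refine top_le_iff.1 ?_
        calc ∞ = ∑' _ : ℕ, (1 : ℝ≥0∞) := (ENNReal.tsum_const_eq_top_of_ne_zero one_ne_zero).symm
          _ ≤ _ := ENNReal.tsum_le_tsum h1
      simp [h2]
    rcases le_or_gt (dist x y) 1 with h1 | h1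
    · obtain ⟨k, hk1, hk2⟩ := exists_nat_pow_near_of_lt_one (dist_pos.2 hne) h1
        (by norm_num : (0 : ℝ) < 1 / 2) (by norm_num)
      refine le_trans ?_ ((ENNReal.le_tsum k).trans le_add_self)
      rw [hf]
      dsimp only
      rw [indicator_of_mem (Metric.mem_closedBall.2 hk2), ENNReal.rpow_neg, ENNReal.rpow_neg,
        ENNReal.inv_le_inv, ← hqr, edist_dist]
      gcongr
    · refine le_trans ?_ le_self_add
      rw [ENNReal.rpow_neg, ENNReal.inv_le_one]
      refine ENNReal.one_le_rpow ?_ hτ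
      rw [edist_dist, ← ENNReal.ofReal_one]
      exact ENNReal.ofReal_le_ofReal h1.le
  calc _ ≤ ∫⁻ x, 1 + ∑' k, f k x ∂(lebesgueTorus d) := lintegral_mono hpt
    _ = 1 + ∑' k, ∫⁻ x, f k x ∂(lebesgueTorus d) := by
      rw [lintegral_add_left measurable_const, lintegral_tsum fun k => (hfm k).aemeasurable]
      simp
    _ ≤ _ := by
      gcongr with k
      rw [hf]
      dsimp only
      rw [lintegral_indicator_const Metric.isClosed_closedBall.measurableSet]
      gcongr
      calc _ ≤ ENNReal.ofReal (min 1 (2 * (1 / 2 : ℝ) ^ k)) ^ d := lebesgueTorus_closedBall_le _ _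
        _ ≤ ENNReal.ofReal (2 * (1 / 2 : ℝ) ^ k) ^ d := by gcongr; exact min_le_right _ _
        _ = _ := by rw [ENNReal.ofReal_mul (by norm_num), hqr]; simp

theorem mutualEnergy_lebesgueTorus_restrict_ne_top {τ : ℝ} (hτ : 0 < τ) (hτd : τ < d)
    (V : Set (Torus d)) :
    mutualEnergy τ ((lebesgueTorus d).restrict V) ((lebesgueTorus d).restrict V) ≠ ∞ := by
  obtain ⟨M, hM, hle⟩ := exists_riesz_potential_le hτ hτd
  refine ne_top_of_le_ne_top hM ?_
  calc _ ≤ mutualEnergy τ (lebesgueTorus d) (lebesgueTorus d) :=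
        mutualEnergy_mono Measure.restrict_le_self Measure.restrict_le_self
    _ ≤ ∫⁻ _, M ∂(lebesgueTorus d) := lintegral_mono hle
    _ = M := by simp

end TorusMeasure

/-! ### Diameters and volumes of dyadic cubes -/

section DyadicCubes

variable {d : ℕ}

theorem Torus.dist_le_half_sqrt (x y : Torus d) : dist x y ≤ √d * 2⁻¹ :=
  Torus.dist_le_sqrt_mul (by norm_num) fun i => by
    rw [dist_eq_norm]
    simpa using AddCircle.norm_le_half_period (1 : ℝ) one_ne_zero (x := x i - y i)

theorem torusProj_dyadicCube_subset_box (n : ℤ) (k : Fin d → ℤ) :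
    torusProj d '' dyadicCube n k ⊆ {x | ∀ i, x i ∈ Metric.closedBall
      ((((k i : ℝ) + 2⁻¹) * 2 ^ (-n) : ℝ) : UnitAddCircle) (2 ^ (-n) / 2)} := by
  rintro _ ⟨y, hy, rfl⟩ i
  rw [Metric.mem_closedBall, dist_eq_norm]
  change ‖((y i : ℝ) : UnitAddCircle) - _‖ ≤ _
  rw [← AddCircle.coe_sub]
  refine (QuotientAddGroup.norm_mk_le_norm (S := AddSubgroup.zmultiples (1 : ℝ))).trans ?_
  have := hy i
  rw [mem_Ico] at this
  rw [Real.norm_eq_abs, abs_le]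
  constructor <;> linarith [this.1, this.2]

theorem box_subset_torusProj_dyadicCube (n : ℤ) (k : Fin d → ℤ) :
    {x : Torus d | ∀ i, x i ∈ Metric.ball
      ((((k i : ℝ) + 2⁻¹) * 2 ^ (-n) : ℝ) : UnitAddCircle) (2 ^ (-n) / 2)} ⊆
      torusProj d '' dyadicCube n k := by
  intro x hx
  have h : ∀ i, ∃ w : ℝ, (w : UnitAddCircle) = x i ∧
      w ∈ Ico ((k i : ℝ) * 2 ^ (-n)) (((k i : ℝ) + 1) * 2 ^ (-n)) := by
    intro i
    obtain ⟨w, hw⟩ := QuotientAddGroup.mk_surjective (x i)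
    have hi := hx i
    rw [← hw, Metric.mem_ball, dist_eq_norm] at hi
    change ‖((w : ℝ) : UnitAddCircle) - _‖ < _ at hi
    rw [← AddCircle.coe_sub, UnitAddCircle.norm_eq, abs_lt] at hi
    -- The representative of `x i` nearest to the midpoint of the side.
    refine ⟨w - round (w - ((k i : ℝ) + 2⁻¹) * 2 ^ (-n)), ?_, ?_, ?_⟩
    · rw [← hw, AddCircle.coe_sub]
      have : ((round (w - ((k i : ℝ) + 2⁻¹) * 2 ^ (-n)) : ℝ) : UnitAddCircle) = 0 :=
        (AddCircle.coe_eq_zero_iff 1).2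
          ⟨round (w - ((k i : ℝ) + 2⁻¹) * 2 ^ (-n)), by simp only [zsmul_eq_mul, mul_one]⟩
      rw [this, sub_zero]
    · linarith [hi.1]
    · linarith [hi.2]
  choose y hy hyI using h
  refine ⟨y, hyI, ?_⟩
  ext i
  exact hy i

/-- For sides at most 1/2 the main diagonal does not wrap around. The cube is half-open, so its
length is only approached, by letting s → 0. -/
theorem le_ediam_torusProj_dyadicCube {n : ℤ} (hn : 1 ≤ n) (k : Fin d → ℤ) :
    ENNReal.ofReal (√d * 2 ^ (-n)) ≤ Metric.ediam (torusProj d '' dyadicCube n k) := by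
  set h : ℝ := 2 ^ (-n) with hh
  have h0 : 0 < h := by positivity
  have h2 : h ≤ 2⁻¹ := by
    rw [hh, ← zpow_neg_one]
    exact zpow_le_zpow_right₀ (by norm_num) (by omega)
  refine le_of_forall_lt fun c hc => ?_
  have hcont : Tendsto (fun s : ℝ => ENNReal.ofReal (√d * (h - s))) (𝓝[>] 0)
      (𝓝 (ENNReal.ofReal (√d * h))) := by
    have : Continuous fun s : ℝ => ENNReal.ofReal (√d * (h - s)) :=
      ENNReal.continuous_ofReal.comp (by fun_prop)
    simpa using (this.tendsto 0).mono_left (nhdsWithin_le_nhds (s := Ioi 0))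
  obtain ⟨s, hs, hs0, hsh⟩ := ((hcont.eventually_const_lt hc).and
    (Ioo_mem_nhdsGT h0)).exists
  refine hs.trans_le ?_
  have hmem : ∀ v ∈ Ico 0 h, torusProj d (fun i => k i * h + v) ∈
      torusProj d '' dyadicCube n k := fun v hv =>
    mem_image_of_mem _ fun i => ⟨by linarith [hv.1], by linarith [hv.2]⟩
  refine le_trans ?_ (Metric.edist_le_ediam_of_mem (hmem (h - s) ⟨by linarith, by linarith⟩)
    (hmem 0 ⟨le_rfl, h0⟩))
  rw [edist_dist, PiLp.dist_eq_of_L2]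
  refine ENNReal.ofReal_le_ofReal (le_of_eq ?_)
  have hd : ∀ i : Fin d, dist (torusProj d (fun i => k i * h + (h - s)) i)
      (torusProj d (fun i => k i * h + 0) i) = h - s := by
    intro i
    rw [dist_eq_norm]
    change ‖((k i * h + (h - s) : ℝ) : UnitAddCircle) - ((k i * h + 0 : ℝ) : UnitAddCircle)‖ = _
    rw [← AddCircle.coe_sub, show k i * h + (h - s) - (k i * h + 0) = h - s by ring,
      (AddCircle.norm_coe_eq_abs_iff 1 one_ne_zero).2, abs_of_pos (by linarith)]
    rw [abs_of_pos (by linarith), abs_one]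
    linarith
  simp_rw [hd]
  simp [Real.sqrt_mul, Real.sqrt_sq (by linarith : 0 ≤ h - s)]

theorem torusProj_dyadicCube_one_subset {n : ℤ} (hn : n ≤ 0) (k : Fin d → ℤ) :
    torusProj d '' dyadicCube 1 (fun _ => 0) ⊆ torusProj d '' dyadicCube n k := by
  rintro _ ⟨y, hy, rfl⟩
  obtain ⟨m, rfl⟩ : ∃ m : ℕ, n = -m := ⟨n.natAbs, by omega⟩
  have h1 : (1 : ℝ) ≤ 2 ^ m := one_le_pow₀ (by norm_num)
  refine ⟨fun i => y i + k i * 2 ^ m, fun i => ?_, ?_⟩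
  · have := hy i
    simp only [Int.cast_zero, zero_mul, zero_add, one_mul, mem_Ico, zpow_neg, zpow_one] at this
    rw [neg_neg, zpow_natCast]
    constructor
    · linarith
    · linarith
  · ext i
    change ((y i + k i * 2 ^ m : ℝ) : UnitAddCircle) = (y i : UnitAddCircle)
    have : ((k i * 2 ^ m : ℝ) : UnitAddCircle) = 0 :=
      (AddCircle.coe_eq_zero_iff 1).2 ⟨k i * 2 ^ m, by simp⟩
    rw [AddCircle.coe_add, this, add_zero]

/-- Here `h` is the side length capped at 1/2. A cube with n ≤ 0 fills the torus, whose diameter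
√d/2 is already that of a cube of side 1/2, so the latter can serve in its place. -/
theorem IsDyadicCube.exists_ediam_le {D : Set (Torus d)} (hD : IsDyadicCube D) :
    ∃ h : ℝ, 0 < h ∧ h ≤ 2⁻¹ ∧ Metric.ediam D ≤ ENNReal.ofReal (√d * h) ∧
      ∃ V : Set (Torus d), IsOpen V ∧ V ⊆ D ∧ ENNReal.ofReal h ^ d ≤ lebesgueTorus d V := by
  obtain ⟨n, k, rfl⟩ := hD
  have hVo : ∀ (c : Fin d → UnitAddCircle) (ρ : ℝ),
      IsOpen {x : Torus d | ∀ i, x i ∈ Metric.ball (c i) ρ} := fun c ρ => by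
    simp only [ofPred_forall]
    exact isOpen_iInter_of_finite fun i =>
      Metric.isOpen_ball.preimage (PiLp.continuous_apply 2 (fun _ : Fin d => UnitAddCircle) i)
  have hV : ∀ (c : Fin d → UnitAddCircle) (h : ℝ), h ≤ 1 →
      ENNReal.ofReal h ^ d ≤ lebesgueTorus d {x | ∀ i, x i ∈ Metric.ball (c i) (h / 2)} := by
    intro c h h1
    rw [lebesgueTorus_box]
    simp_rw [← measure_congr (AddCircle.closedBall_ae_eq_ball (T := 1)),
      AddCircle.volume_closedBall]
    simp [mul_div_cancel₀, h1]
  rcases le_or_gt 1 n with hn | hn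
  · have h2 : (2 : ℝ) ^ (-n) ≤ 2⁻¹ := by
      rw [← zpow_neg_one]
      exact zpow_le_zpow_right₀ (by norm_num) (by omega)
    refine ⟨2 ^ (-n), by positivity, h2, ?_, _, hVo _ _, box_subset_torusProj_dyadicCube n k,
      hV _ _ (h2.trans (by norm_num))⟩
    refine Metric.ediam_le fun x hx y hy => ?_
    rw [edist_dist]
    refine ENNReal.ofReal_le_ofReal (Torus.dist_le_sqrt_mul (by positivity) fun i => ?_)
    have h3 := torusProj_dyadicCube_subset_box n k hx i
    have h4 := torusProj_dyadicCube_subset_box n k hy i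
    rw [Metric.mem_closedBall] at h3 h4
    linarith [dist_triangle_right (x i) (y i)
      ((((k i : ℝ) + 2⁻¹) * 2 ^ (-n) : ℝ) : UnitAddCircle)]
  · have h2 : (2 : ℝ) ^ (-1 : ℤ) = 2⁻¹ := zpow_neg_one 2
    refine ⟨2⁻¹, by norm_num, le_rfl, ?_, _, hVo _ _,
      (box_subset_torusProj_dyadicCube 1 fun _ => 0).trans
        (torusProj_dyadicCube_one_subset (by omega) k), ?_⟩
    · refine Metric.ediam_le fun x hx y hy => ?_
      rw [edist_dist]
      exact ENNReal.ofReal_le_ofReal (Torus.dist_le_half_sqrt x y)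
    · rw [h2]
      exact hV _ _ (by norm_num)

theorem IsDyadicCube.exists_le_ediam {Q : Set (Torus d)} (hQ : IsDyadicCube Q) :
    ENNReal.ofReal (√d * 2⁻¹) ≤ Metric.ediam Q ∨
      ∃ q : ℝ, 0 < q ∧ ENNReal.ofReal (√d * q) ≤ Metric.ediam Q ∧
        lebesgueTorus d (closure Q) ≤ ENNReal.ofReal q ^ d := by
  obtain ⟨n, k, rfl⟩ := hQ
  rcases le_or_gt 1 n with hn | hn
  · refine .inr ⟨2 ^ (-n), by positivity, le_ediam_torusProj_dyadicCube hn k, ?_⟩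
    have hclosed : IsClosed {x : Torus d | ∀ i, x i ∈ Metric.closedBall
        ((((k i : ℝ) + 2⁻¹) * 2 ^ (-n) : ℝ) : UnitAddCircle) (2 ^ (-n) / 2)} := by
      simp only [ofPred_forall]
      exact isClosed_iInter fun i => Metric.isClosed_closedBall.preimage
        (PiLp.continuous_apply 2 (fun _ : Fin d => UnitAddCircle) i)
    calc _ ≤ _ := measure_mono (closure_minimal (torusProj_dyadicCube_subset_box n k) hclosed)
      _ = ENNReal.ofReal (min 1 (2 * (2 ^ (-n) / 2))) ^ d := by
        rw [lebesgueTorus_box]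
        simp [AddCircle.volume_closedBall]
      _ ≤ _ := by
        gcongr
        rw [mul_div_cancel₀ _ two_ne_zero]
        exact min_le_right _ _
  · left
    rw [← zpow_neg_one]
    exact (le_ediam_torusProj_dyadicCube le_rfl _).trans
      (Metric.ediam_mono (torusProj_dyadicCube_one_subset (by omega) k))

end DyadicCubes

/-! ### Content and Hausdorff measure of the limsup set -/

section LargeIntersections

variable {d : ℕ} {x : ℕ → Torus d} {r : ℕ → ℝ} {W : ℕ → Set (Torus d)} {t τ : ℝ}

/-- A covering cube at least as wide as `D` settles the matter alone. Otherwise every covering cube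
has side q ≤ h, so q^d ≤ h^(d-τ) q^τ, and h^d ≤ ν(V) ≤ ∑ q^d gives h^τ ≤ ∑ q^τ; the factors √d^τ
agree on both sides. -/
theorem IsEnergySystem.ediam_rpow_le_dyadicContent
    (hS : IsEnergySystem (lebesgueTorus d) t x r W) (hτ : 0 < τ) (hτt : τ < t) (htd : t ≤ d)
    {E : Set (Torus d)} (hE : limsup (fun j => closure (W j)) atTop ⊆ E)
    {D : Set (Torus d)} (hD : IsDyadicCube D) :
    Metric.ediam D ^ τ ≤ dyadicContent τ (E ∩ D) := by
  refine le_iInf₂ fun 𝒞 h𝒞 => le_iInf₂ fun h𝒞D hcov => ?_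
  obtain ⟨h, h0, h2, hDh, V, hV, hVD, hVh⟩ := hD.exists_ediam_le
  have hd : 0 < d := by
    have : (0 : ℝ) < d := by linarith
    exact_mod_cast this
  have hsd : 0 < √(d : ℝ) := Real.sqrt_pos.2 (by exact_mod_cast hd)
  have := h𝒞.to_subtype
  by_cases hbig : ∃ Q : 𝒞, Metric.ediam D ≤ Metric.ediam (Q : Set (Torus d))
  · obtain ⟨Q, hQ⟩ := hbig
    calc _ ≤ Metric.ediam (Q : Set (Torus d)) ^ τ := by gcongr
      _ ≤ _ := ENNReal.le_tsum Q
  push Not at hbig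
  by_cases htop : ∑' Q : 𝒞, Metric.ediam (Q : Set (Torus d)) ^ τ = ∞
  · rw [htop]; exact le_top
  set A := ENNReal.ofReal (√d * h) ^ τ with hA
  set v := ENNReal.ofReal h ^ d with hv
  have hv0 : v ≠ 0 := pow_ne_zero _ (by simpa)
  have hvtop : v ≠ ∞ := ENNReal.pow_ne_top ENNReal.ofReal_ne_top
  have hmain := hS.measure_le_tsum_closure hτ hτt hV
    (mutualEnergy_lebesgueTorus_restrict_ne_top hτ (by linarith) V)
    (fun Q : 𝒞 => (Q : Set (Torus d))) htop (fun z hz => by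
      have := hcov ⟨hE hz.2, hVD hz.1⟩
      rwa [sUnion_eq_iUnion] at this)
  have hQ : ∀ Q : 𝒞, lebesgueTorus d (closure (Q : Set (Torus d))) * A ≤
      v * Metric.ediam (Q : Set (Torus d)) ^ τ := by
    intro Q
    rcases (h𝒞D Q Q.2).exists_le_ediam with hQ | ⟨q, hq0, hq1, hq2⟩
    · refine absurd (hbig Q) (not_lt.2 (hDh.trans (le_trans ?_ hQ)))
      exact ENNReal.ofReal_le_ofReal (by gcongr)
    · have hqh : q ≤ h := by
        have h3 := (hq1.trans_lt ((hbig Q).trans_le hDh)).le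
        rw [ENNReal.ofReal_le_ofReal_iff (by positivity)] at h3
        exact le_of_mul_le_mul_left h3 hsd
      calc _ ≤ ENNReal.ofReal q ^ d * A := by gcongr
        _ ≤ v * ENNReal.ofReal (√d * q) ^ τ := by
          rw [hA, hv, ENNReal.ofReal_rpow_of_nonneg (by positivity) hτ.le,
            ENNReal.ofReal_rpow_of_nonneg (by positivity) hτ.le, ← ENNReal.ofReal_pow hq0.le,
            ← ENNReal.ofReal_pow h0.le, ← ENNReal.ofReal_mul (by positivity),
            ← ENNReal.ofReal_mul (by positivity)]
          refine ENNReal.ofReal_le_ofReal ?_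
          rw [Real.mul_rpow hsd.le h0.le, Real.mul_rpow hsd.le hq0.le]
          have e : ∀ u : ℝ, 0 < u → u ^ d = u ^ ((d : ℝ) - τ) * u ^ τ := fun u hu => by
            rw [← Real.rpow_add hu, sub_add_cancel, Real.rpow_natCast]
          rw [e q hq0, e h h0]
          have : q ^ ((d : ℝ) - τ) ≤ h ^ ((d : ℝ) - τ) :=
            Real.rpow_le_rpow hq0.le hqh (by linarith)
          calc _ = q ^ ((d : ℝ) - τ) * (q ^ τ * √d ^ τ * h ^ τ) := by ring
            _ ≤ h ^ ((d : ℝ) - τ) * (q ^ τ * √d ^ τ * h ^ τ) := by gcongr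
            _ = _ := by ring
        _ ≤ _ := by gcongr
  calc Metric.ediam D ^ τ ≤ A := by rw [hA]; gcongr
    _ ≤ ∑' Q : 𝒞, Metric.ediam (Q : Set (Torus d)) ^ τ := by
      rw [← ENNReal.mul_le_mul_iff_right hv0 hvtop]
      calc v * A ≤ (∑' Q : 𝒞, lebesgueTorus d (closure (Q : Set (Torus d)))) * A := by
            gcongr
            exact hVh.trans hmain
        _ ≤ _ := by
            rw [← ENNReal.tsum_mul_right, ← ENNReal.tsum_mul_left]
            exact ENNReal.tsum_le_tsum hQ

/-- A cover by sets of diameter at most 1 has 1 ≤ ∑ ν(closure S_n) ≤ 2^d ∑ |S_n|^d ≤ 2^d ∑ |S_n|^τ,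
so its sum cannot fall below 2^(-d). -/
theorem IsEnergySystem.hausdorffMeasure_ne_zero
    (hS : IsEnergySystem (lebesgueTorus d) t x r W) (hτ : 0 < τ) (hτt : τ < t) (htd : t ≤ d)
    {E : Set (Torus d)} (hE : limsup (fun j => closure (W j)) atTop ⊆ E) :
    μH[τ] E ≠ 0 := by
  intro h0
  rw [Measure.hausdorffMeasure_apply] at h0
  have h1 : (⨅ (S : ℕ → Set (Torus d)) (_ : E ⊆ ⋃ n, S n) (_ : ∀ n, Metric.ediam (S n) ≤ 1),
      ∑' n, ⨆ _ : (S n).Nonempty, Metric.ediam (S n) ^ τ) < (2 ^ d)⁻¹ := by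
    refine lt_of_le_of_lt ?_ (by simp : (0 : ℝ≥0∞) < (2 ^ d)⁻¹)
    rw [← h0]
    exact le_iSup₂ (f := fun (R : ℝ≥0∞) (_ : 0 < R) =>
      ⨅ (S : ℕ → Set (Torus d)) (_ : E ⊆ ⋃ n, S n) (_ : ∀ n, Metric.ediam (S n) ≤ R),
      ∑' n, ⨆ _ : (S n).Nonempty, Metric.ediam (S n) ^ τ) 1 one_pos
  simp only [iInf_lt_iff] at h1
  obtain ⟨S, hES, hS1, hlt⟩ := h1
  have hterm : ∀ n, (⨆ _ : (S n).Nonempty, Metric.ediam (S n) ^ τ) = Metric.ediam (S n) ^ τ := by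
    intro n
    rcases (S n).eq_empty_or_nonempty with h | h
    · simp [h, ENNReal.zero_rpow_of_pos hτ]
    · simp [h]
  simp_rw [hterm] at hlt
  have hmain := hS.measure_le_tsum_closure hτ hτt isOpen_univ
    (mutualEnergy_lebesgueTorus_restrict_ne_top hτ (by linarith) univ) S
    (hlt.trans_le le_top).ne ((inter_subset_right.trans hE).trans hES)
  rw [measure_univ] at hmain
  refine absurd hmain (not_le.2 ?_)
  calc _ ≤ ∑' n, 2 ^ d * Metric.ediam (S n) ^ τ := by
        refine ENNReal.tsum_le_tsum fun n => (lebesgueTorus_closure_le_ediam (S n)).trans ?_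
        gcongr
        rw [← ENNReal.rpow_natCast]
        exact ENNReal.rpow_le_rpow_of_exponent_ge (hS1 n) (by linarith)
    _ = 2 ^ d * ∑' n, Metric.ediam (S n) ^ τ := ENNReal.tsum_mul_left
    _ < 2 ^ d * (2 ^ d)⁻¹ := ENNReal.mul_lt_mul_right (by simp) (by simp) hlt
    _ = 1 := ENNReal.mul_inv_cancel (by simp) (by simp)

end LargeIntersections

theorem theorem1 (d : ℕ) (x : ℕ → Torus d) (r : ℕ → ℝ) (U : ℕ → Set (Torus d))
    (hr : Tendsto r atTop (𝓝 0))
    (hUo : ∀ j, IsOpen (U j)) (hUne : ∀ j, (U j).Nonempty)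
    (hUB : ∀ j, U j ⊆ Metric.ball (x j) (r j))
    (hfull : lebesgueTorus d (limsup (fun j => Metric.ball (x j) (r j)) atTop)ᶜ = 0) :
    ENNReal.ofReal (energyExponent x r U) ≤ dimH (limsup U atTop) ∧
      limsup U atTop ∈ largeIntersectionClass d (energyExponent x r U) := by
  have hsystem : ∀ τ : ℝ, 0 < τ → τ < energyExponent x r U → ∃ t W, τ < t ∧ t ≤ d ∧
      IsEnergySystem (lebesgueTorus d) t x r W ∧
      limsup (fun j => closure (W j)) atTop ⊆ limsup U atTop := by
    intro τ hτ hlt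
    have hne : {t : ℝ | 0 < t ∧ t < d ∧
        ⨆ j, rieszEnergy t (U j) * lebesgueTorus d (Metric.ball (x j) (r j)) /
          lebesgueTorus d (U j) ^ 2 < ∞}.Nonempty := by
      -- Without admissible exponents (in particular for d = 0) the supremum is 0 by convention,
      -- which excludes 0 < τ below it.
      by_contra h
      rw [not_nonempty_iff_eq_empty] at h
      rw [energyExponent, h, Real.sSup_empty] at hlt
      linarith
    obtain ⟨t, ⟨-, htd, ht⟩, hτt⟩ := exists_lt_of_lt_csSup hne hlt
    obtain ⟨W, hW, hWU⟩ := exists_isEnergySystem lebesgueTorus_doubling hr hUo hUne hUB hfull ht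
    exact ⟨t, W, hτt, htd.le, hW, limsup_le_limsup (.of_forall hWU)⟩
  refine ⟨?_, ?_, fun D hD τ hτ hlt => ?_⟩
  · refine le_of_forall_lt fun c hc => ?_
    lift c to NNReal using (hc.trans_le le_top).ne
    obtain ⟨τ, hcτ, hτ⟩ := exists_between hc
    lift τ to NNReal using (hτ.trans_le le_top).ne
    refine hcτ.trans_le ?_
    have hτ0 : (0 : ℝ) < τ := by
      have : c < τ := by exact_mod_cast hcτ
      exact_mod_cast zero_le.trans_lt this
    obtain ⟨t, W, hτt, htd, hW, hsub⟩ := hsystem τ hτ0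
      ((ENNReal.lt_ofReal_iff_toReal_lt ENNReal.coe_ne_top).1 hτ)
    exact le_dimH_of_hausdorffMeasure_ne_zero (hW.hausdorffMeasure_ne_zero hτ0 hτt htd hsub)
  · rw [limsup_eq_iInf_iSup_of_nat]
    simp only [iInf_eq_iInter, iSup_eq_iUnion]
    exact IsGδ.iInter_of_isOpen fun n => isOpen_biUnion fun j _ => hUo j
  · obtain ⟨t, W, hτt, htd, hW, hsub⟩ := hsystem τ hτ hlt
    exact hW.ediam_rpow_le_dyadicContent hτ hτt htd hsub hD
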